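/- Let $N,b,L\ge 1$ be integers. Consider a periodic chain of $L$ sites with on-site Hilbert space $\mathbb C^d$ and an on-site unitary $U$ of order $N$; put $U_g=U^g$ for $g\in\mathbb Z_N$. The exponential and dipole-exponential symmetries are $$\mathcal U_{E,g}=\bigotimes_j U_g^{\,b^{j-1}},\qquad \mathcal U_{DE,g}=\bigotimes_j U_g^{\,j\,b^{j-1}},$$ so the on-site group is $\mathbb Z_N\times\mathbb Z_N$, the element $(m,n)$ acting on site $j\ge1$ by $U_{(m,n),j}=U_m^{\,b^{j-1}}U_n^{\,jb^{j-1}}$. **Periodicity.** Both symmetries are well defined on the ring of $L$ sites (that is, $U^{f(j+L)}=U^{f(j)}$ for all $j\ge1$ and both $f(j)=b^{j-1}$ and $f(j)=jb^{j-1}$) if and only if $L\equiv0$ and $b^L\equiv1 \pmod N$. These conditions imply $\gcd(b,N)=1$; conversely, if $\gcd(b,N)=1$, then every $L=k\,\varphi(N)\,N$ with $k\in\mathbb N$ satisfies them. **Bond unitaries.** Let $A=(A^s)_{s=1}^d$ be a left-canonical injective MPS tensor of bond dimension $D\geq 1$: $\sum_s A^{s\dagger}A^s=\mathbb 1$, $\sum_sA^s\rho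 A^{s\dagger}=\rho$ for some positive definite $\rho$, and the eigenvalue $1$ of the transfer matrix $X\mapsto\sum_sA^{s\dagger}XA^s$ has a one-dimensional eigenspace while all other eigenvalues have modulus $<1$. Call $A$ *symmetric* if both symmetries are well defined on the ring of $L$ sites and, for every $k\ge1$ and every $g\in\mathbb Z_N\times\mathbb Z_N$, the state $\sum\mathrm{Tr}(A^{s_1}\cdots A^{s_{kL}})|s_1\dots s_{kL}\rangle$ is multiplied by a phase by the $k$-fold periodic extension of $\bigotimes_{j=1}^L U_{g,j}$. Write $\doteq$ for equality up to a phase. For every symmetric $A$ there are unitaries $v_j(g)$, $j\ge0$, $g\in\mathbb Z_N\times\mathbb Z_N$, with $U_{g,j}\cdot A\doteq v_{j-1}(g)^\dagger A\,v_j(g)$ for all $j\ge1$ (the phase depending on $j$ and $g$ only). For every such choice, with $v_{e,j}(g)=v_j(g,0)$ and $v_{de,j}(g)=v_j(0,g)$, one has for all $j\ge1$ $$v_{e,j}(g)\doteq v_{e,j-1}(g)^b,\qquad v_{de,j}(g)\doteq v_{de,j-1}(g)^b\,v_{e,j}(g)\doteq v_{de,j-1}(g)^b\,v_{e,j-1}(g)^b;$$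 every $v_j$ is a projective representation, $v_j(g)v_j(h)=\omega_j(g,h)v_j(g+h)$, whose class $[\omega_j]\in H^2(\mathbb Z_N\times\mathbb Z_N,U(1))$ depends neither on $j$ nor on the choice of the $v_j$. This class is called the (strong) SPT class of the MPS. **Classification.** The coboundary-invariant phase $\omega(e,f)/\omega(f,e)=e^{2\pi ik/N}$, where $e=(1,0)$ and $f=(0,1)$, gives an isomorphism $[\omega]\mapsto k$ from $H^2(\mathbb Z_N\times\mathbb Z_N,U(1))$ onto $\mathbb Z_N$. For a symmetric $A$ with SPT class labelled by $k$, $$v_{e,j}(1)\,v_{de,j}(1)\,v_{e,j}(1)^\dagger\,v_{de,j}(1)^\dagger=e^{2\pi ik/N}\,\mathbb 1\quad\text{for all } j,\qquad\text{and}\qquad k(b^2-1)\equiv0\pmod N.$$ If $L\equiv0$ and $b^L\equiv1\pmod N$, then the SPT classes that occur (over all $d$, $D$, all $U$ of order $N$ and all symmetric $A$) are exactly those with $k(b^2-1)\equiv0\pmod N$. They form a subgroup of $H^2(\mathbb Z_N\times\mathbb Z_N,U(1))$ isomorphic to $\mathbb Z_{\gcd(b^2-1,N)}$. -/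

import Mathlib

open scoped Matrix ComplexOrder

noncomputable section

namespace TiltedExp

/-! ### Second group cohomology with `U(1)` coefficients (trivial action) -/

/-- The group of 2-cocycles `ω : G × G → U(1)` of an (additively written) abelian group `G`. -/
def Z2 (G : Type*) [AddCommGroup G] : Subgroup (G → G → Circle) where
  carrier := {ω | ∀ g h l, ω g h * ω (g + h) l = ω h l * ω g (h + l)}
  one_mem' := by intro g h l; simp
  mul_mem' := by
    intro ω₁ ω₂ h₁ h₂ g h l
    have e := congrArg₂ (· * ·) (h₁ g h l) (h₂ g h l)
    simpa [mul_mul_mul_comm] using e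
  inv_mem' := by
    intro ω hω g h l
    have e := congrArg (·⁻¹) (hω g h l)
    simpa [mul_comm] using e

/-- The 2-coboundaries `(g, h) ↦ β(g) β(h) β(g + h)⁻¹`, as a subgroup of the 2-cocycles. -/
def B2 (G : Type*) [AddCommGroup G] : Subgroup (Z2 G) where
  carrier := {ω | ∃ β : G → Circle, ∀ g h, ω.1 g h = β g * β h * (β (g + h))⁻¹}
  one_mem' := ⟨fun _ => 1, by intro g h; simp⟩
  mul_mem' := by
    rintro ω₁ ω₂ ⟨β₁, h₁⟩ ⟨β₂, h₂⟩
    refine ⟨fun g => β₁ g * β₂ g, fun g h => ?_⟩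
    have e : (ω₁ * ω₂).1 g h = ω₁.1 g h * ω₂.1 g h := rfl
    rw [e, h₁ g h, h₂ g h]
    change _ = β₁ g * β₂ g * (β₁ h * β₂ h) * (β₁ (g + h) * β₂ (g + h))⁻¹
    rw [mul_inv]
    ac_rfl
  inv_mem' := by
    rintro ω ⟨β, hβ⟩
    refine ⟨fun g => (β g)⁻¹, fun g h => ?_⟩
    simp only [Subgroup.coe_inv, Pi.inv_apply, hβ g h, mul_inv]

/-- `H²(G, U(1))`. -/
abbrev H2 (G : Type*) [AddCommGroup G] : Type _ := Z2 G ⧸ B2 G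

/-- The class of a 2-cocycle in `H²(G, U(1))`. -/
def H2.mk {G : Type*} [AddCommGroup G] (ω : Z2 G) : H2 G := QuotientGroup.mk ω

/-! ### The modulated symmetry -/

/-- The on-site group `ℤ_N × ℤ_N`: the first factor labels the exponential symmetry, the second
one the dipole-exponential symmetry. -/
abbrev G (N : ℕ) : Type := ZMod N × ZMod N

/-- Modulation function `b^(j-1)` of the exponential symmetry, at sites `j = 1, 2, …`. -/
def expMod (b j : ℕ) : ℕ := b ^ (j - 1)

/-- Modulation function `j b^(j-1)` of the dipole-exponential symmetry. -/
def dipExpMod (b j : ℕ) : ℕ := j * b ^ (j - 1)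

/-- The modulated operator `⨂_j U^(f j)` is well defined on a periodic chain of length `L`:
going once around the chain reproduces the same on-site operators. -/
def WellDefinedOnRing {d : ℕ} (U : Matrix (Fin d) (Fin d) ℂ) (f : ℕ → ℕ) (L : ℕ) : Prop :=
  ∀ j, 1 ≤ j → U ^ f (j + L) = U ^ f j

/-- On-site operator at site `j` of the element `g = (m, n)`:
the product of `U_m^(b^(j-1))` and `U_n^(j b^(j-1))`, where `U_m = U^m`. -/
def onSite {d : ℕ} (N b : ℕ) (U : Matrix (Fin d) (Fin d) ℂ) (g : G N) (j : ℕ) :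
    Matrix (Fin d) (Fin d) ℂ :=
  (U ^ g.1.val) ^ expMod b j * (U ^ g.2.val) ^ dipExpMod b j

/-- The tensor product operator `u 0 ⊗ ⋯ ⊗ u (n-1)` on a chain of `n` sites, in the basis of
spin configurations. -/
def chainOp {d n : ℕ} (u : Fin n → Matrix (Fin d) (Fin d) ℂ) :
    Matrix (Fin n → Fin d) (Fin n → Fin d) ℂ :=
  fun σ τ => ∏ i, u i (σ i) (τ i)

/-- The symmetry operator of `g` on a chain of `k * L` sites: the `k`-fold periodic extension of
the operator on `L` sites (position `i` in `Fin (k * L)` is site `i % L + 1` of its cell). -/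
def symOp {d : ℕ} (N b L k : ℕ) (U : Matrix (Fin d) (Fin d) ℂ) (g : G N) :
    Matrix (Fin (k * L) → Fin d) (Fin (k * L) → Fin d) ℂ :=
  chainOp fun i => onSite N b U g (i.val % L + 1)

/-! ### Matrix product states -/

/-- The translation invariant MPS on a periodic chain of `n` sites:
`ψ(s₁, …, s_n) = Tr(A^{s₁} ⋯ A^{s_n})`. -/
def mpsState {d D : ℕ} (A : Fin d → Matrix (Fin D) (Fin D) ℂ) (n : ℕ) :
    (Fin n → Fin d) → ℂ :=
  fun σ => ((List.ofFn fun i => A (σ i)).prod).trace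

/-- The transfer matrix, as a map on bond matrices. -/
def transfer {d D : ℕ} (A : Fin d → Matrix (Fin D) (Fin D) ℂ) (X : Matrix (Fin D) (Fin D) ℂ) :
    Matrix (Fin D) (Fin D) ℂ :=
  ∑ s, (A s)ᴴ * X * A s

/-- Injective MPS tensors in left-canonical form: `1` is the left and a positive definite `ρ` the
right eigenvector of the transfer matrix for the eigenvalue `1`, which is the unique dominant
eigenvalue: it has a one-dimensional eigenspace, and every other eigenvalue lies strictly inside
the unit circle. -/
structure IsInjectiveMPS {d D : ℕ} (A : Fin d → Matrix (Fin D) (Fin D) ℂ) : Prop where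
  bond_pos : 0 < D
  left_canonical : ∑ s, (A s)ᴴ * A s = 1
  right_canonical : ∃ ρ : Matrix (Fin D) (Fin D) ℂ, ρ.PosDef ∧ ∑ s, A s * ρ * (A s)ᴴ = ρ
  gap : ∀ (μ : ℂ) (X : Matrix (Fin D) (Fin D) ℂ), X ≠ 0 → transfer A X = μ • X →
    ‖μ‖ < 1 ∨ (μ = 1 ∧ ∃ a : ℂ, X = a • (1 : Matrix (Fin D) (Fin D) ℂ))

/-- `A` generates a translation invariant injective MPS with the tilted exponential symmetry
generated by an on-site unitary `U` of order `N`: the symmetry is well defined on a periodic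
chain of `L` sites, and for every `k ≥ 1` the MPS on `k * L` sites is an eigenstate of the
periodically extended symmetry operators. -/
structure IsSymmetricMPS {d D : ℕ} (N b L : ℕ) (U : Matrix (Fin d) (Fin d) ℂ)
    (A : Fin d → Matrix (Fin D) (Fin D) ℂ) : Prop where
  unitary : U ∈ Matrix.unitaryGroup (Fin d) ℂ
  order : orderOf U = N
  ring_exp : WellDefinedOnRing U (expMod b) L
  ring_dipExp : WellDefinedOnRing U (dipExpMod b) L
  injective : IsInjectiveMPS A
  symmetric : ∀ (g : G N) (k : ℕ), 1 ≤ k → ∃ c : Circle,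
    symOp N b L k U g *ᵥ mpsState A (k * L) = (c : ℂ) • mpsState A (k * L)

/-! ### Bond unitaries -/

/-- Equality up to a phase. -/
def PhaseEq {D : ℕ} (X Y : Matrix (Fin D) (Fin D) ℂ) : Prop :=
  ∃ c : Circle, X = (c : ℂ) • Y

/-- `v j g` is a system of unitaries on the bonds `j = 0, 1, 2, …` (site `j + 1` lies between the
bonds `j` and `j + 1`) through which the symmetry is pushed:
`U_{g,j+1} · A ≐ v_j(g)† A v_{j+1}(g)`. -/
structure IsBondUnitaries {d D : ℕ} (N b : ℕ) (U : Matrix (Fin d) (Fin d) ℂ)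
    (A : Fin d → Matrix (Fin D) (Fin D) ℂ) (v : ℕ → G N → Matrix (Fin D) (Fin D) ℂ) : Prop where
  unitary : ∀ j g, v j g ∈ Matrix.unitaryGroup (Fin D) ℂ
  push : ∀ j g, ∃ c : Circle, ∀ s,
    ∑ s', onSite N b U g (j + 1) s s' • A s' = (c : ℂ) • ((v j g)ᴴ * A s * v (j + 1) g)

/-- Bond unitary of the element `g` of the exponential symmetry. -/
def vE {D N : ℕ} (v : ℕ → G N → Matrix (Fin D) (Fin D) ℂ) (j : ℕ) (g : ZMod N) :
    Matrix (Fin D) (Fin D) ℂ := v j (g, 0)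

/-- Bond unitary of the element `g` of the dipole-exponential symmetry. -/
def vDE {D N : ℕ} (v : ℕ → G N → Matrix (Fin D) (Fin D) ℂ) (j : ℕ) (g : ZMod N) :
    Matrix (Fin D) (Fin D) ℂ := v j (0, g)

/-- The (strong) SPT class of the MPS is `c ∈ H²(ℤ_N × ℤ_N, U(1))`: bond unitaries exist, and
for every choice of them they form, on every bond, a projective representation of class `c`. -/
def HasSPTClass {d D : ℕ} (N b : ℕ) (U : Matrix (Fin d) (Fin d) ℂ)
    (A : Fin d → Matrix (Fin D) (Fin D) ℂ) (c : H2 (G N)) : Prop :=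
  (∃ v, IsBondUnitaries N b U A v) ∧
  ∀ v, IsBondUnitaries N b U A v → ∀ j, ∃ ω : Z2 (G N),
    (∀ g h, v j g * v j h = (ω.1 g h : ℂ) • v j (g + h)) ∧ H2.mk ω = c

/-- `c` is the SPT class of some injective MPS with the tilted exponential symmetry on a chain of
length `L` (for some physical dimension, on-site unitary of order `N`, and bond dimension). -/
def IsSPTClass (N b L : ℕ) (c : H2 (G N)) : Prop :=
  ∃ (d D : ℕ) (U : Matrix (Fin d) (Fin d) ℂ) (A : Fin d → Matrix (Fin D) (Fin D) ℂ),
    IsSymmetricMPS N b L U A ∧ HasSPTClass N b U A c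

/-- The phase `exp(2πik/N)` of `k ∈ ℤ_N`. -/
def phase (N : ℕ) (k : ZMod N) : ℂ :=
  Complex.exp (2 * Real.pi * Complex.I * (k.val : ℂ) / (N : ℂ))

end TiltedExp

end

noncomputable section

namespace TiltedExp

/-! ### `H²(ℤ_N × ℤ_N, U(1)) ≅ ℤ_N` -/

/-! The central fact is a uniqueness statement (`IsPush.phaseEq`): for an injective tensor, the
unitaries that carry given site operators to the bonds are determined up to phases. If `v` and `v'`
both do so, the transfer matrix maps `v'_j v_j†` to `v'_{j+1} v_{j+1}†` up to a phase. Its powers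
converge to a projection onto the multiples of `1`, and a unitary whose weighted norm survives this
limit is itself a phase. Hence identities between site operators descend to the bonds up to phases:
the relations `b^j = b·b^(j-1)` and `(j+1)b^j = b·(j b^(j-1)) + b^j` give the recursions for the
bond unitaries, and multiplicativity in `g` gives projective representations.

Existence is the fundamental theorem (`exists_unitary_of_state_eq`). Traces of powers of the mixed
transfer matrix are overlaps of states and do not decay, so there is an eigenvalue of modulus at
least 1. That map is also a contraction for the weighted norm, and the equality case of
Cauchy-Schwarz turns the eigenvector into a gauge transformation, unitary after rescaling.

The phases in the push relation compare the cocycles on neighbouring bonds, so the class does not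
depend on the bond (`mk_succ_eq`). The recursions, however, turn the commutator phase `q` into
`q^(b²)`; thus `q^(b²) = q`, which is `k(b²-1) = 0`. Conversely, such a `k` is realised by a
cluster-like tensor with generalised Pauli bond unitaries, of bond dimension `n` equal to the order
of `exp(-2πi bk/N)`; modulo this `n` one has `b² = 1`.

The group `H²` is computed with central extensions: generators lift to elements of order dividing
`N`, and if these lifts commute they give a homomorphic section. -/

theorem H2.mk_eq_mk_iff {G : Type*} [AddCommGroup G] (ω₁ ω₂ : Z2 G) :
    H2.mk ω₁ = H2.mk ω₂ ↔ ∃ β : G → Circle, ∀ g h,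
      ω₂.1 g h = ω₁.1 g h * (β g * β h * (β (g + h))⁻¹) := by
  unfold H2.mk
  rw [QuotientGroup.eq]
  refine exists_congr fun β => forall_congr' fun g => forall_congr' fun h => ?_
  change (ω₁.1 g h)⁻¹ * ω₂.1 g h = _ ↔ _
  rw [inv_mul_eq_iff_eq_mul]

theorem Z2.zero_left {G : Type*} [AddCommGroup G] (ω : Z2 G) (g : G) :
    ω.1 0 g = ω.1 0 0 := by
  have h := ω.2 0 0 g
  simp only [zero_add] at h
  exact (mul_right_cancel h).symm

theorem Z2.zero_right {G : Type*} [AddCommGroup G] (ω : Z2 G) (g : G) :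
    ω.1 g 0 = ω.1 0 0 := by
  have h := ω.2 g 0 0
  simp only [add_zero] at h
  exact mul_right_cancel h

/-- The central extension of `G` by `U(1)` attached to a 2-cocycle. -/
@[ext] structure CentralExt {G : Type*} [AddCommGroup G] (ω : Z2 G) where
  base : G
  phase : Circle

namespace CentralExt

variable {G : Type*} [AddCommGroup G] {ω : Z2 G}

instance : Monoid (CentralExt ω) where
  mul x y := ⟨x.base + y.base, x.phase * y.phase * ω.1 x.base y.base⟩
  -- Cocycles are not assumed normalised, so the unit carries the phase that compensates `ω(0,0)`.
  one := ⟨0, (ω.1 0 0)⁻¹⟩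
  mul_assoc x y z := by
    refine CentralExt.ext (add_assoc _ _ _) ?_
    change x.phase * y.phase * ω.1 x.base y.base * z.phase * ω.1 (x.base + y.base) z.base =
      x.phase * (y.phase * z.phase * ω.1 y.base z.base) * ω.1 x.base (y.base + z.base)
    calc _ = x.phase * y.phase * z.phase * (ω.1 x.base y.base * ω.1 (x.base + y.base) z.base) := by
          ac_rfl
      _ = x.phase * y.phase * z.phase * (ω.1 y.base z.base * ω.1 x.base (y.base + z.base)) := by
          rw [ω.2]
      _ = _ := by ac_rfl
  one_mul x := by
    refine CentralExt.ext (zero_add _) ?_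
    change (ω.1 0 0)⁻¹ * x.phase * ω.1 0 x.base = x.phase
    rw [Z2.zero_left ω x.base, mul_right_comm, inv_mul_cancel, one_mul]
  mul_one x := by
    refine CentralExt.ext (add_zero _) ?_
    change x.phase * (ω.1 0 0)⁻¹ * ω.1 x.base 0 = x.phase
    rw [Z2.zero_right ω x.base, inv_mul_cancel_right]

theorem base_mul (x y : CentralExt ω) : (x * y).base = x.base + y.base := rfl

theorem phase_mul (x y : CentralExt ω) :
    (x * y).phase = x.phase * y.phase * ω.1 x.base y.base := rfl

theorem base_one : (1 : CentralExt ω).base = 0 := rfl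

theorem phase_one : (1 : CentralExt ω).phase = (ω.1 0 0)⁻¹ := rfl

theorem base_pow (x : CentralExt ω) (n : ℕ) : (x ^ n).base = n • x.base := by
  induction n with
  | zero => simp [base_one]
  | succ n ih => rw [pow_succ, base_mul, ih, succ_nsmul]

/-- The chosen phase enters a power only through `z ^ n`; divisibility of the circle then allows the
power of a lift to be corrected to `1`. -/
theorem exists_phase_pow (ω : Z2 G) (g : G) (n : ℕ) :
    ∃ γ : Circle, ∀ z, ((⟨g, z⟩ : CentralExt ω) ^ n).phase = z ^ n * γ := by
  induction n with
  | zero => exact ⟨(ω.1 0 0)⁻¹, fun z => by simp [phase_one]⟩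
  | succ n ih =>
    obtain ⟨γ, hγ⟩ := ih
    refine ⟨γ * ω.1 (n • g) g, fun z => ?_⟩
    rw [pow_succ, phase_mul, hγ, base_pow, pow_succ]
    simp only [mul_assoc, mul_left_comm]

theorem exists_circle_pow_eq (z : Circle) {n : ℕ} (hn : n ≠ 0) : ∃ w : Circle, w ^ n = z := by
  refine ⟨Circle.exp (Complex.arg z / n), ?_⟩
  rw [← Circle.exp_nsmul, nsmul_eq_mul, mul_div_cancel₀ _ (by exact_mod_cast hn), Circle.exp_arg]

/-- An element of order dividing `n` has a lift of order dividing `n`. -/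
theorem exists_lift_pow_eq_one (ω : Z2 G) (g : G) {n : ℕ} (hn : n ≠ 0) (hg : n • g = 0) :
    ∃ z, (⟨g, z⟩ : CentralExt ω) ^ n = 1 := by
  obtain ⟨γ, hγ⟩ := exists_phase_pow ω g n
  obtain ⟨z, hz⟩ := exists_circle_pow_eq ((ω.1 0 0)⁻¹ * γ⁻¹) hn
  refine ⟨z, CentralExt.ext (by rw [base_pow, base_one]; exact hg) ?_⟩
  rw [hγ, hz, phase_one, inv_mul_cancel_right]

end CentralExt

section ZModSq

variable {N : ℕ} [NeZero N]

open CentralExt in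
/-- The commutator phase of a cocycle on `ℤ_N × ℤ_N` is an `N`-th root of unity. -/
theorem Z2.commutator_pow (ω : Z2 (G N)) :
    (ω.1 (1, 0) (0, 1) / ω.1 (0, 1) (1, 0)) ^ N = 1 := by
  obtain ⟨z, hz⟩ := exists_lift_pow_eq_one ω ((1, 0) : G N) (NeZero.ne N) (by simp)
  set x : CentralExt ω := ⟨(1, 0), z⟩
  set y : CentralExt ω := ⟨(0, 1), 1⟩
  set c := ω.1 (1, 0) (0, 1) / ω.1 (0, 1) (1, 0) with hc
  -- Each factor `x` moved past `y` costs one `c`. At `n = N` the power of `x` is trivial, which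
  -- forces `c ^ N = 1`.
  have key : ∀ n : ℕ, (x ^ n * y).phase = c ^ n * (y * x ^ n).phase := by
    intro n
    induction n with
    | zero => simp
    | succ n ih =>
      have h1 : (x * y).phase = c * (y * x).phase := by
        rw [phase_mul, phase_mul, hc]
        simp only [x, y, one_mul, mul_one]
        rw [mul_left_comm, div_mul_cancel]
      have h2 : ∀ u v w : CentralExt ω, u.base = v.base → ∀ t : Circle, u.phase = t * v.phase →
          (u * w).phase = t * (v * w).phase ∧ (w * u).phase = t * (w * v).phase := by
        intro u v w hb t ht
        simp only [phase_mul, hb, ht]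
        exact ⟨by ac_rfl, by ac_rfl⟩
      have e1 := (h2 (x * y) (y * x) (x ^ n) (add_comm _ _) c h1).2
      have e2 := (h2 (x ^ n * y) (y * x ^ n) x (add_comm _ _) (c ^ n) ih).1
      rw [pow_succ x, mul_assoc, e1, ← mul_assoc (x ^ n), e2, mul_assoc y, pow_succ c]
      ac_rfl
  have h := key N
  rw [hz, one_mul, mul_one] at h
  exact (mul_eq_right.mp h.symm)

open CentralExt in
/-- A cocycle on `ℤ_N × ℤ_N` with trivial commutator phase is a coboundary. -/
theorem Z2.exists_coboundary (ω : Z2 (G N)) (hω : ω.1 (1, 0) (0, 1) = ω.1 (0, 1) (1, 0)) :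
    ∃ β : G N → Circle, ∀ g h, ω.1 g h = β g * β h * (β (g + h))⁻¹ := by
  obtain ⟨z, hz⟩ := exists_lift_pow_eq_one ω ((1, 0) : G N) (NeZero.ne N) (by simp)
  obtain ⟨w, hw⟩ := exists_lift_pow_eq_one ω ((0, 1) : G N) (NeZero.ne N) (by simp)
  set x : CentralExt ω := ⟨(1, 0), z⟩
  set y : CentralExt ω := ⟨(0, 1), w⟩
  have hxy : Commute x y := by
    refine CentralExt.ext (add_comm _ _) ?_
    rw [phase_mul, phase_mul]
    simp only [x, y, hω, mul_comm]
  have hadd : ∀ (u : CentralExt ω), u ^ N = 1 → ∀ a b : ZMod N,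
      u ^ (a + b).val = u ^ a.val * u ^ b.val := by
    intro u hu a b
    rw [ZMod.val_add, ← pow_add, pow_eq_pow_mod (a.val + b.val) hu]
  -- Commuting lifts of exponent `N` give a homomorphic section; comparing phases in `s (g + h) = s
  -- g * s h` exhibits `ω` as the coboundary of the inverse phase of `s`.
  let s : G N → CentralExt ω := fun g => x ^ g.1.val * y ^ g.2.val
  have hs : ∀ g h, s (g + h) = s g * s h := by
    intro g h
    change x ^ (g.1 + h.1).val * y ^ (g.2 + h.2).val = _
    rw [hadd x hz, hadd y hw, mul_assoc, ← mul_assoc (x ^ h.1.val),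
      (hxy.pow_pow h.1.val g.2.val).eq]
    simp only [s, mul_assoc]
  have hb : ∀ g, (s g).base = g := by
    intro g
    rw [base_mul, base_pow, base_pow]
    ext <;> simp [x, y]
  refine ⟨fun g => ((s g).phase)⁻¹, fun g h => ?_⟩
  simp only [hs, phase_mul, hb, inv_inv]
  rw [← mul_inv, ← mul_assoc, inv_mul_cancel, one_mul]

/-- The bilinear cocycle with commutator phase `exp(2πik/N)`. -/
def bilinearCocycle (k : ZMod N) : Z2 (G N) :=
  ⟨fun g h => ZMod.toCircle (k * (g.1 * h.2)), by
    intro g h l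
    simp only [← AddChar.map_add_eq_mul]
    congr 1
    simp only [Prod.fst_add, Prod.snd_add]
    ring⟩

/-- Cohomology classes as a function of the commutator phase. -/
def classOfPhase (N : ℕ) [NeZero N] : Multiplicative (ZMod N) →* H2 (G N) where
  toFun k := H2.mk (bilinearCocycle k.toAdd)
  map_one' := by
    refine congrArg QuotientGroup.mk (Subtype.ext ?_)
    funext g h
    simp [bilinearCocycle]
  map_mul' k l := by
    refine congrArg (QuotientGroup.mk (s := B2 (G N)))
      (a₂ := bilinearCocycle k.toAdd * bilinearCocycle l.toAdd) (Subtype.ext ?_)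
    funext g h
    change ZMod.toCircle _ = ZMod.toCircle _ * ZMod.toCircle _
    rw [← AddChar.map_add_eq_mul, toAdd_mul, add_mul]

theorem exists_toCircle_eq (c : Circle) (hc : c ^ N = 1) : ∃ k : ZMod N, ZMod.toCircle k = c := by
  obtain ⟨k, hk⟩ := (bijective_rootsOfUnityAddChar N).2
    ⟨toUnits c, by rw [mem_rootsOfUnity, ← map_pow, hc, map_one]⟩
  refine ⟨k, ?_⟩
  have h := congrArg (fun u : rootsOfUnity N Circle => ((u : Circleˣ) : Circle)) hk
  simpa using h

/-- A coboundary is symmetric in its two arguments, so it drops out of the quotient. Conversely,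
dividing by the bilinear cocycle of the same commutator phase leaves a cocycle to which
`Z2.exists_coboundary` applies. -/
theorem mk_eq_classOfPhase_iff (ω : Z2 (G N)) (k : ZMod N) :
    H2.mk ω = classOfPhase N (Multiplicative.ofAdd k) ↔
      ω.1 (1, 0) (0, 1) / ω.1 (0, 1) (1, 0) = ZMod.toCircle k := by
  constructor
  · intro h
    obtain ⟨β, hβ⟩ := (H2.mk_eq_mk_iff _ _).1 h.symm
    rw [hβ, hβ, add_comm, mul_comm (β (1, 0)), mul_div_mul_right_eq_div]
    simp [bilinearCocycle]
  · intro h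
    obtain ⟨β, hβ⟩ := Z2.exists_coboundary (ω * (bilinearCocycle k)⁻¹) (by
      change ω.1 (1, 0) (0, 1) * (ZMod.toCircle _)⁻¹ = ω.1 (0, 1) (1, 0) * (ZMod.toCircle _)⁻¹
      rw [← div_eq_mul_inv, div_eq_iff_eq_mul]
      rw [div_eq_iff_eq_mul] at h
      rw [h]
      simp [mul_comm])
    refine ((H2.mk_eq_mk_iff (bilinearCocycle k) ω).2 ⟨β, fun g h => ?_⟩).symm
    rw [← hβ]
    change _ = _ * (ω.1 g h * ((bilinearCocycle k).1 g h)⁻¹)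
    rw [mul_left_comm, mul_inv_cancel, mul_one]

theorem classOfPhase_bijective : Function.Bijective (classOfPhase N) := by
  constructor
  · rw [injective_iff_map_eq_one]
    intro k hk
    have h := (mk_eq_classOfPhase_iff (1 : Z2 (G N)) k.toAdd).1 (hk.symm ▸ rfl)
    have h0 : ZMod.toCircle k.toAdd = ZMod.toCircle (0 : ZMod N) := by
      rw [← h, AddChar.map_zero_eq_one]
      exact div_self' _
    exact ZMod.injective_toCircle h0
  · intro c
    obtain ⟨ω, rfl⟩ := QuotientGroup.mk_surjective c
    obtain ⟨k, hk⟩ := exists_toCircle_eq _ (Z2.commutator_pow ω)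
    exact ⟨Multiplicative.ofAdd k, ((mk_eq_classOfPhase_iff ω k).2 hk.symm).symm⟩

/-- The isomorphism `H²(ℤ_N × ℤ_N, U(1)) ≅ ℤ_N` given by the commutator phase. -/
def phaseLabel (N : ℕ) [NeZero N] : H2 (G N) ≃* Multiplicative (ZMod N) :=
  (MulEquiv.ofBijective (classOfPhase N) classOfPhase_bijective).symm

theorem phaseLabel_mk_eq_iff (ω : Z2 (G N)) (k : ZMod N) :
    phaseLabel N (H2.mk ω) = Multiplicative.ofAdd k ↔
      ω.1 (1, 0) (0, 1) / ω.1 (0, 1) (1, 0) = ZMod.toCircle k := by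
  rw [← mk_eq_classOfPhase_iff]
  exact MulEquiv.symm_apply_eq _

theorem phase_eq_toCircle (k : ZMod N) : phase N k = ZMod.toCircle k :=
  (ZMod.toCircle_apply k).symm

theorem commutator_eq_toCircle (ω : Z2 (G N)) :
    ω.1 (1, 0) (0, 1) / ω.1 (0, 1) (1, 0) =
      ZMod.toCircle (phaseLabel N (H2.mk ω)).toAdd :=
  (phaseLabel_mk_eq_iff ω _).1 rfl

/-- The `m`-torsion of `ℤ_N`, transported along an isomorphism, is cyclic of order `gcd(m, N)`. -/
theorem exists_torsion_subgroup {H : Type*} [CommGroup H] (κ : H ≃* Multiplicative (ZMod N))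
    (m : ℕ) : ∃ P : Subgroup H, (∀ c, c ∈ P ↔ (κ c).toAdd * (m : ZMod N) = 0) ∧
      Nonempty (P ≃* Multiplicative (ZMod (Nat.gcd m N))) := by
  let f : Multiplicative (ZMod N) →* Multiplicative (ZMod N) := powMonoidHom m
  refine ⟨f.ker.comap κ.toMonoidHom, fun c => ?_, ⟨?_⟩⟩
  · change (κ c) ^ m = 1 ↔ _
    rw [← toAdd_eq_zero, toAdd_pow, nsmul_eq_mul, mul_comm]
  · have e : f.ker.comap κ.toMonoidHom ≃* f.ker :=
      κ.subgroupMap _ |>.trans (MulEquiv.subgroupCongr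
        (Subgroup.map_comap_eq_self_of_surjective κ.surjective _))
    -- Both sides are cyclic, so equal cardinality suffices.
    refine e.trans (mulEquivOfCyclicCardEq ?_)
    rw [IsCyclic.card_powMonoidHom_ker, Nat.card_congr Multiplicative.toAdd, Nat.card_zmod,
      Nat.card_congr Multiplicative.toAdd, Nat.card_zmod, Nat.gcd_comm]

end ZModSq

open Filter Topology

/-! ### Powers of an endomorphism whose eigenvalues lie inside the unit circle -/

section LinftyNorm

attribute [local instance] Matrix.linftyOpNormedRing Matrix.linftyOpNormedAlgebra

/-- Gelfand's formula: for `r` strictly between the spectral radius and 1, eventually `‖M ^ n‖ ≤ r ^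
n`. -/
theorem matrix_pow_tendsto_zero {ι : Type*} [Fintype ι] [DecidableEq ι] (M : Matrix ι ι ℂ)
    (hM : ∀ μ ∈ spectrum ℂ M, ‖μ‖ < 1) : Tendsto (fun n : ℕ => M ^ n) atTop (𝓝 0) := by
  cases isEmpty_or_nonempty ι
  · exact (tendsto_const_nhds (x := (0 : Matrix ι ι ℂ))).congr fun n => Subsingleton.elim _ _
  have : CompleteSpace (Matrix ι ι ℂ) := FiniteDimensional.complete ℂ _
  have hr : spectralRadius ℂ M < 1 :=
    spectrum.spectralRadius_lt_of_forall_lt M (r := 1) fun z hz => hM z hz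
  obtain ⟨r, hr1, hr2⟩ := ENNReal.lt_iff_exists_nnreal_btwn.1 hr
  have hev := (spectrum.pow_nnnorm_pow_one_div_tendsto_nhds_spectralRadius M).eventually_lt_const hr1
  have hr1' : (r : ℝ) < 1 := by exact_mod_cast hr2
  refine squeeze_zero_norm' (a := fun n : ℕ => (r : ℝ) ^ n) ?_
    (tendsto_pow_atTop_nhds_zero_of_lt_one r.2 hr1')
  filter_upwards [hev, eventually_gt_atTop 0] with n hn hn0
  have h1 : ((‖M ^ n‖₊ : ENNReal) ^ (1 / n : ℝ)) ^ (n : ℝ) ≤ (r : ENNReal) ^ (n : ℝ) :=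
    ENNReal.rpow_le_rpow hn.le (Nat.cast_nonneg n)
  rw [← ENNReal.rpow_mul, one_div, inv_mul_cancel₀ (by exact_mod_cast hn0.ne'), ENNReal.rpow_one,
    ENNReal.rpow_natCast, ← ENNReal.coe_pow, ENNReal.coe_le_coe] at h1
  exact_mod_cast h1

end LinftyNorm

section EndPow

variable {V : Type*} [AddCommGroup V] [Module ℂ V] [FiniteDimensional ℂ V] (T : Module.End ℂ V)

theorem toMatrix_pow_tendsto_zero {ι : Type*} [Fintype ι] [DecidableEq ι]
    (B : Module.Basis ι ℂ V) (hT : ∀ μ, T.HasEigenvalue μ → ‖μ‖ < 1) :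
    Tendsto (fun n : ℕ => LinearMap.toMatrix B B (T ^ n)) atTop (𝓝 0) := by
  have h := matrix_pow_tendsto_zero (LinearMap.toMatrixAlgEquiv B T) (by
    intro μ hμ
    rw [AlgEquiv.spectrum_eq] at hμ
    exact hT μ (Module.End.hasEigenvalue_iff_mem_spectrum.2 hμ))
  refine h.congr fun n => ?_
  rw [← map_pow]
  rfl

theorem trace_pow_tendsto_zero (hT : ∀ μ, T.HasEigenvalue μ → ‖μ‖ < 1) :
    Tendsto (fun n : ℕ => LinearMap.trace ℂ V (T ^ n)) atTop (𝓝 0) := by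
  let B := Module.finBasis ℂ V
  have h := (Continuous.matrix_trace continuous_id).continuousAt.tendsto.comp
    (toMatrix_pow_tendsto_zero T B hT)
  simp only [id, Matrix.trace_zero] at h
  exact h.congr fun n => (LinearMap.trace_eq_matrix_trace ℂ B _).symm

theorem pow_apply_tendsto_zero [TopologicalSpace V] [IsTopologicalAddGroup V]
    [ContinuousSMul ℂ V] (hT : ∀ μ, T.HasEigenvalue μ → ‖μ‖ < 1) (x : V) :
    Tendsto (fun n : ℕ => (T ^ n) x) atTop (𝓝 0) := by
  let B := Module.finBasis ℂ V
  have hc : Continuous fun M : Matrix _ _ ℂ => B.equivFun.symm (M *ᵥ B.equivFun x) :=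
    (B.equivFun.symm.toLinearMap.continuous_of_finiteDimensional).comp
      (continuous_id.matrix_mulVec continuous_const)
  have h := hc.continuousAt.tendsto.comp (toMatrix_pow_tendsto_zero T B hT)
  simp only [Matrix.zero_mulVec, map_zero] at h
  refine h.congr fun n => ?_
  simp only [Function.comp_apply]
  rw [LinearEquiv.symm_apply_eq]
  exact LinearMap.toMatrix_mulVec_repr B B (T ^ n) x

end EndPow

/-! ### The transfer matrix of an injective MPS -/

section Transfer

variable {d D : ℕ}

/-- The mixed transfer matrix of two tensors. -/
def mixedTransfer (B A : Fin d → Matrix (Fin D) (Fin D) ℂ) :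
    Module.End ℂ (Matrix (Fin D) (Fin D) ℂ) where
  toFun X := ∑ s, (B s)ᴴ * X * A s
  map_add' X Y := by simp only [mul_add, add_mul, Finset.sum_add_distrib]
  map_smul' c X := by simp [Finset.smul_sum]

theorem mixedTransfer_apply (B A : Fin d → Matrix (Fin D) (Fin D) ℂ)
    (X : Matrix (Fin D) (Fin D) ℂ) : mixedTransfer B A X = ∑ s, (B s)ᴴ * X * A s := rfl

/-- Squared norm of a bond matrix, weighted by `ρ`. -/
def wnorm (ρ X : Matrix (Fin D) (Fin D) ℂ) : ℂ := (ρ * (Xᴴ * X)).trace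

theorem wnorm_eq (ρ X : Matrix (Fin D) (Fin D) ℂ) : wnorm ρ X = (X * ρ * Xᴴ).trace := by
  rw [wnorm, ← mul_assoc, Matrix.trace_mul_comm, ← mul_assoc]

theorem wnorm_nonneg {ρ : Matrix (Fin D) (Fin D) ℂ} (hρ : ρ.PosDef)
    (X : Matrix (Fin D) (Fin D) ℂ) : 0 ≤ wnorm ρ X := by
  rw [wnorm_eq]
  exact (hρ.posSemidef.mul_mul_conjTranspose_same X).trace_nonneg

theorem eq_zero_of_wnorm_eq_zero {ρ : Matrix (Fin D) (Fin D) ℂ} (hρ : ρ.PosDef)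
    {X : Matrix (Fin D) (Fin D) ℂ} (h : wnorm ρ X = 0) : X = 0 := by
  rw [wnorm_eq, (hρ.posSemidef.mul_mul_conjTranspose_same X).trace_eq_zero_iff] at h
  by_contra hX
  -- The diagonal entry of `X ρ Xᴴ` at `i` is the quadratic form of `ρ` at the column `i` of `Xᴴ`,
  -- hence positive for a nonzero column.
  obtain ⟨i, hi⟩ : ∃ i, Xᴴ.col i ≠ 0 := by
    by_contra! hc
    apply hX
    rw [← Matrix.conjTranspose_eq_zero]
    ext a b
    exact congrFun (hc b) a
  have h1 := hρ.dotProduct_mulVec_pos hi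
  have h2 : star (Xᴴ.col i) ⬝ᵥ ρ *ᵥ (Xᴴ.col i) = (X * ρ * Xᴴ) i i := by
    rw [Matrix.mul_assoc]
    simp [Matrix.mul_apply, dotProduct, Matrix.mulVec, Matrix.col_apply]
  rw [h2, h] at h1
  simp at h1

theorem wnorm_smul (ρ X : Matrix (Fin D) (Fin D) ℂ) (c : ℂ) :
    wnorm ρ (c • X) = ((‖c‖ ^ 2 : ℝ) : ℂ) * wnorm ρ X := by
  simp only [wnorm, Matrix.conjTranspose_smul, Matrix.smul_mul, Matrix.mul_smul, smul_smul,
    Matrix.trace_smul, smul_eq_mul]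
  congr 1
  rw [Complex.ofReal_pow, ← Complex.mul_conj']
  rfl

/-- Equality case of the Cauchy-Schwarz inequality for the mixed transfer matrix. -/
theorem sum_wnorm_sub {A B : Fin d → Matrix (Fin D) (Fin D) ℂ} {ρ : Matrix (Fin D) (Fin D) ℂ}
    (hA : ∑ s, A s * ρ * (A s)ᴴ = ρ) (hB : ∑ s, (B s)ᴴ * B s = 1)
    (X : Matrix (Fin D) (Fin D) ℂ) :
    ∑ s, wnorm ρ (X * A s - B s * mixedTransfer B A X) =
      wnorm ρ X - wnorm ρ (mixedTransfer B A X) := by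
  set Y := mixedTransfer B A X with hY
  have hY' : Yᴴ = ∑ s, (A s)ᴴ * Xᴴ * B s := by
    rw [hY, mixedTransfer_apply, Matrix.conjTranspose_sum]
    simp [Matrix.mul_assoc]
  -- Of the four terms of the expanded square, this one gives the norm of `X` because `ρ` is fixed;
  -- the other three each give the norm of `Y`, the last one by left-canonicity of `B`.
  have e1 : ∑ s, (ρ * ((A s)ᴴ * Xᴴ * (X * A s))).trace = wnorm ρ X := by
    have : ∀ s, (ρ * ((A s)ᴴ * Xᴴ * (X * A s))).trace = (A s * ρ * (A s)ᴴ * (Xᴴ * X)).trace := by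
      intro s
      calc _ = ((ρ * (A s)ᴴ * Xᴴ * X) * A s).trace := by simp only [Matrix.mul_assoc]
        _ = _ := by rw [Matrix.trace_mul_comm]; simp only [Matrix.mul_assoc]
    rw [Finset.sum_congr rfl fun s _ => this s, ← Matrix.trace_sum, ← Finset.sum_mul, hA, wnorm]
  have e2 : ∑ s, (ρ * ((A s)ᴴ * Xᴴ * (B s * Y))).trace = wnorm ρ Y := by
    rw [← Matrix.trace_sum, ← Finset.mul_sum, wnorm, hY', Finset.sum_mul]
    simp only [Matrix.mul_assoc]
  have e3 : ∑ s, (ρ * (Yᴴ * (B s)ᴴ * (X * A s))).trace = wnorm ρ Y := by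
    rw [← Matrix.trace_sum, ← Finset.mul_sum, wnorm]
    nth_rw 3 [hY]
    rw [mixedTransfer_apply, Finset.mul_sum, Finset.mul_sum, Finset.mul_sum]
    simp only [Matrix.mul_assoc]
  have e4 : ∑ s, (ρ * (Yᴴ * (B s)ᴴ * (B s * Y))).trace = wnorm ρ Y := by
    have : ∀ s, Yᴴ * (B s)ᴴ * (B s * Y) = Yᴴ * ((B s)ᴴ * B s) * Y := by
      intro s; simp only [Matrix.mul_assoc]
    simp only [this]
    rw [← Matrix.trace_sum, ← Finset.mul_sum, ← Finset.sum_mul, ← Finset.mul_sum, hB, wnorm,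
      mul_one]
  have e5 : ∀ s, wnorm ρ (X * A s - B s * Y) = (ρ * ((A s)ᴴ * Xᴴ * (X * A s))).trace
      - (ρ * ((A s)ᴴ * Xᴴ * (B s * Y))).trace - ((ρ * (Yᴴ * (B s)ᴴ * (X * A s))).trace
      - (ρ * (Yᴴ * (B s)ᴴ * (B s * Y))).trace) := by
    intro s
    rw [wnorm, Matrix.conjTranspose_sub, Matrix.conjTranspose_mul, Matrix.conjTranspose_mul,
      sub_mul, mul_sub, mul_sub, mul_sub, mul_sub, mul_sub, Matrix.trace_sub, Matrix.trace_sub,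
      Matrix.trace_sub]
  simp only [e5, Finset.sum_sub_distrib, e1, e2, e3, e4]
  ring

/-- Contraction in the weighted norm, since the defect in `sum_wnorm_sub` is a sum of nonnegative
terms. -/
theorem wnorm_mixedTransfer_le {A B : Fin d → Matrix (Fin D) (Fin D) ℂ}
    {ρ : Matrix (Fin D) (Fin D) ℂ} (hρ : ρ.PosDef)
    (hA : ∑ s, A s * ρ * (A s)ᴴ = ρ) (hB : ∑ s, (B s)ᴴ * B s = 1)
    (X : Matrix (Fin D) (Fin D) ℂ) :
    wnorm ρ (mixedTransfer B A X) ≤ wnorm ρ X := by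
  rw [← sub_nonneg, ← sum_wnorm_sub hA hB]
  exact Finset.sum_nonneg fun s _ => wnorm_nonneg hρ _

/-- Without loss of norm every summand of the defect vanishes, and positivity of `ρ` makes the
intertwining relation exact. -/
theorem intertwine_of_wnorm_eq {A B : Fin d → Matrix (Fin D) (Fin D) ℂ}
    {ρ : Matrix (Fin D) (Fin D) ℂ} (hρ : ρ.PosDef)
    (hA : ∑ s, A s * ρ * (A s)ᴴ = ρ) (hB : ∑ s, (B s)ᴴ * B s = 1)
    {X : Matrix (Fin D) (Fin D) ℂ} (h : wnorm ρ (mixedTransfer B A X) = wnorm ρ X) (s : Fin d) :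
    X * A s = B s * mixedTransfer B A X := by
  have h0 := sum_wnorm_sub hA hB X
  rw [h, sub_self, Finset.sum_eq_zero_iff_of_nonneg fun s _ => wnorm_nonneg hρ _] at h0
  exact sub_eq_zero.1 (eq_zero_of_wnorm_eq_zero hρ (h0 s (Finset.mem_univ s)))

/-- The Gram matrix of an intertwiner evolves under the transfer matrix of `A` alone, where the
spectral gap is available. -/
theorem conjTranspose_mul_self_mixedTransfer {A B : Fin d → Matrix (Fin D) (Fin D) ℂ}
    (hB : ∑ s, (B s)ᴴ * B s = 1) {X Y : Matrix (Fin D) (Fin D) ℂ}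
    (h : ∀ s, X * A s = B s * Y) : mixedTransfer A A (Xᴴ * X) = Yᴴ * Y := by
  have : ∀ s, (A s)ᴴ * (Xᴴ * X) * A s = Yᴴ * ((B s)ᴴ * B s) * Y := by
    intro s
    calc _ = (X * A s)ᴴ * (X * A s) := by simp only [Matrix.conjTranspose_mul, Matrix.mul_assoc]
      _ = _ := by rw [h]; simp only [Matrix.conjTranspose_mul, Matrix.mul_assoc]
  rw [mixedTransfer_apply, Finset.sum_congr rfl fun s _ => this s, ← Finset.sum_mul,
    ← Finset.mul_sum, hB, mul_one]

namespace IsInjectiveMPS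

variable {A : Fin d → Matrix (Fin D) (Fin D) ℂ}

theorem mixedTransfer_one (hA : IsInjectiveMPS A) : mixedTransfer A A 1 = 1 := by
  simpa [mixedTransfer_apply] using hA.left_canonical

theorem one_ne_zero (hA : IsInjectiveMPS A) : (1 : Matrix (Fin D) (Fin D) ℂ) ≠ 0 := by
  have : Nonempty (Fin D) := ⟨⟨0, hA.bond_pos⟩⟩
  exact _root_.one_ne_zero

theorem trace_pos (hA : IsInjectiveMPS A) {ρ : Matrix (Fin D) (Fin D) ℂ} (hρ : ρ.PosDef) :
    ρ.trace ≠ 0 := by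
  have : Nonempty (Fin D) := ⟨⟨0, hA.bond_pos⟩⟩
  exact hρ.trace_pos.ne'

/-- The projection onto the multiples of `1` given by the fixed point `ρ`. -/
def meanProj (ρ : Matrix (Fin D) (Fin D) ℂ) : Module.End ℂ (Matrix (Fin D) (Fin D) ℂ) :=
  ((ρ.trace)⁻¹ • (Matrix.traceLinearMap (Fin D) ℂ ℂ ∘ₗ LinearMap.mulLeft ℂ ρ)).smulRight 1

theorem meanProj_apply (ρ X : Matrix (Fin D) (Fin D) ℂ) :
    meanProj ρ X = ((ρ.trace)⁻¹ * (ρ * X).trace) • 1 := rfl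

theorem mixedTransfer_mul_meanProj (hA : IsInjectiveMPS A) (ρ : Matrix (Fin D) (Fin D) ℂ) :
    mixedTransfer A A * meanProj ρ = meanProj ρ := by
  ext1 X
  rw [Module.End.mul_apply, meanProj_apply, map_smul, hA.mixedTransfer_one]

theorem meanProj_mul_mixedTransfer {ρ : Matrix (Fin D) (Fin D) ℂ}
    (hf : ∑ s, A s * ρ * (A s)ᴴ = ρ) : meanProj ρ * mixedTransfer A A = meanProj ρ := by
  ext1 X
  rw [Module.End.mul_apply, meanProj_apply, meanProj_apply]
  congr 2
  rw [mixedTransfer_apply, Finset.mul_sum, Matrix.trace_sum]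
  conv_rhs => rw [← hf, Finset.sum_mul, Matrix.trace_sum]
  refine Finset.sum_congr rfl fun s _ => ?_
  rw [← mul_assoc, Matrix.trace_mul_comm]
  simp only [Matrix.mul_assoc]

theorem meanProj_one (hA : IsInjectiveMPS A) {ρ : Matrix (Fin D) (Fin D) ℂ}
    (hρ : ρ.PosDef) : meanProj ρ 1 = 1 := by
  rw [meanProj_apply, mul_one, inv_mul_cancel₀ (hA.trace_pos hρ), one_smul]

theorem meanProj_mul_self (hA : IsInjectiveMPS A) {ρ : Matrix (Fin D) (Fin D) ℂ}
    (hρ : ρ.PosDef) : meanProj ρ * meanProj ρ = meanProj ρ := by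
  ext1 X
  rw [Module.End.mul_apply, meanProj_apply ρ X, map_smul, hA.meanProj_one hρ]

/-- The projection absorbs the transfer matrix on either side, so subtracting it removes the
eigenvalue 1 from all positive powers; exponent 0 has to be excluded. -/
theorem pow_sub_meanProj (hA : IsInjectiveMPS A) {ρ : Matrix (Fin D) (Fin D) ℂ}
    (hρ : ρ.PosDef) (hf : ∑ s, A s * ρ * (A s)ᴴ = ρ) (n : ℕ) :
    (mixedTransfer A A - meanProj ρ) ^ (n + 1) = mixedTransfer A A ^ (n + 1) - meanProj ρ := by
  have h4 : ∀ m, meanProj ρ * mixedTransfer A A ^ m = meanProj ρ := by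
    intro m
    induction m with
    | zero => simp
    | succ m ih => rw [pow_succ, ← mul_assoc, ih, meanProj_mul_mixedTransfer hf]
  induction n with
  | zero => simp
  | succ n ih =>
    rw [pow_succ', ih, sub_mul, mul_sub, mul_sub, hA.mixedTransfer_mul_meanProj,
      hA.meanProj_mul_self hρ, h4, ← pow_succ', sub_self, sub_zero]

/-- An eigenvector for `μ ≠ 0` is killed by the projection, so it is an eigenvector of the transfer
matrix that is not a multiple of `1`; the gap then applies. -/
theorem eigenvalue_sub_meanProj (hA : IsInjectiveMPS A) {ρ : Matrix (Fin D) (Fin D) ℂ}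
    (hρ : ρ.PosDef) (hf : ∑ s, A s * ρ * (A s)ᴴ = ρ) (μ : ℂ)
    (hμ : (mixedTransfer A A - meanProj ρ).HasEigenvalue μ) : ‖μ‖ < 1 := by
  by_cases h0 : μ = 0
  · simp [h0]
  obtain ⟨X, hX⟩ := hμ.exists_hasEigenvector
  have hX1 := hX.apply_eq_smul
  have hP : meanProj ρ X = 0 := by
    have h := congrArg (meanProj ρ) hX1
    rw [← Module.End.mul_apply, mul_sub, meanProj_mul_mixedTransfer hf, hA.meanProj_mul_self hρ,
      sub_self, LinearMap.zero_apply, map_smul] at h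
    exact (smul_eq_zero.1 h.symm).resolve_left h0
  rw [LinearMap.sub_apply, hP, sub_zero] at hX1
  rcases hA.gap μ X hX.2 hX1 with h | ⟨-, a, rfl⟩
  · exact h
  · rw [map_smul, hA.meanProj_one hρ] at hP
    exact absurd hP hX.2

theorem tendsto_pow_apply (hA : IsInjectiveMPS A) {ρ : Matrix (Fin D) (Fin D) ℂ}
    (hρ : ρ.PosDef) (hf : ∑ s, A s * ρ * (A s)ᴴ = ρ) (X : Matrix (Fin D) (Fin D) ℂ) :
    Tendsto (fun n : ℕ => (mixedTransfer A A ^ n) X) atTop (𝓝 (meanProj ρ X)) := by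
  have h := ((pow_apply_tendsto_zero _ (hA.eigenvalue_sub_meanProj hρ hf) X).comp
    (tendsto_add_atTop_nat 1)).add_const (meanProj ρ X)
  rw [zero_add] at h
  refine (tendsto_add_atTop_iff_nat 1).1 (h.congr fun n => ?_)
  simp only [Function.comp_apply]
  rw [hA.pow_sub_meanProj hρ hf, LinearMap.sub_apply, sub_add_cancel]

/-- The limiting projection has rank one, hence trace 1. In terms of states, the squared norm of the
MPS tends to 1. -/
theorem tendsto_trace_pow (hA : IsInjectiveMPS A) :
    Tendsto (fun n : ℕ => LinearMap.trace ℂ _ (mixedTransfer A A ^ n)) atTop (𝓝 1) := by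
  obtain ⟨ρ, hρ, hf⟩ := hA.right_canonical
  have h := ((trace_pow_tendsto_zero _ (hA.eigenvalue_sub_meanProj hρ hf)).comp
    (tendsto_add_atTop_nat 1)).add_const 1
  rw [zero_add] at h
  refine (tendsto_add_atTop_iff_nat 1).1 (h.congr fun n => ?_)
  have ht : LinearMap.trace ℂ _ (meanProj ρ) = 1 := by
    rw [meanProj, LinearMap.trace_smulRight, LinearMap.smul_apply, LinearMap.comp_apply,
      LinearMap.mulLeft_apply, mul_one]
    exact inv_mul_cancel₀ (hA.trace_pos hρ)
  simp only [Function.comp_apply]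
  rw [hA.pow_sub_meanProj hρ hf, map_sub, ht, sub_add_cancel]

/-- A fixed point of a power of the transfer matrix is a multiple of `1`. -/
theorem eq_smul_one_of_pow_fixed (hA : IsInjectiveMPS A) {n : ℕ} (hn : 0 < n)
    {X : Matrix (Fin D) (Fin D) ℂ} (hX : (mixedTransfer A A ^ n) X = X) :
    ∃ a : ℂ, X = a • (1 : Matrix (Fin D) (Fin D) ℂ) := by
  obtain ⟨ρ, hρ, hf⟩ := hA.right_canonical
  -- Along the multiples of `n` the orbit of `X` is constant, so `X` equals its own mean projection.
  have h := (hA.tendsto_pow_apply hρ hf X).comp (tendsto_id.nsmul_atTop hn)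
  have hc : ∀ k : ℕ, (mixedTransfer A A ^ (n * k)) X = X := by
    intro k
    induction k with
    | zero => simp
    | succ k ih => rw [mul_add, pow_add, mul_one, Module.End.mul_apply, hX, ih]
  exact ⟨_, tendsto_nhds_unique (tendsto_const_nhds.congr fun k => (hc k).symm) h⟩

end IsInjectiveMPS

end Transfer

/-! ### Composition of mixed transfer matrices along a chain -/

section Chain

variable {d D : ℕ}

/-- The map `X ↦ C X E` is `C ⊗ Eᵀ` in the basis of matrix units. -/
theorem trace_mulLeft_comp_mulRight (C E : Matrix (Fin D) (Fin D) ℂ) :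
    LinearMap.trace ℂ _ (LinearMap.mulLeft ℂ C ∘ₗ LinearMap.mulRight ℂ E) =
      C.trace * E.trace := by
  have hrepr : ∀ (M : Matrix (Fin D) (Fin D) ℂ) (p : Fin D × Fin D),
      (Matrix.stdBasis ℂ (Fin D) (Fin D)).repr M p = M p.1 p.2 := by
    intro M p
    simp [Matrix.stdBasis]
  rw [LinearMap.trace_eq_matrix_trace ℂ (Matrix.stdBasis ℂ (Fin D) (Fin D)), Matrix.trace,
    Fintype.sum_prod_type, Matrix.trace, Matrix.trace, Finset.sum_mul_sum]
  refine Finset.sum_congr rfl fun i _ => Finset.sum_congr rfl fun j _ => ?_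
  rw [Matrix.diag_apply, LinearMap.toMatrix_apply, hrepr, Matrix.stdBasis_eq_single]
  simp [Matrix.mul_apply, Matrix.single_apply, ite_and]

/-- Composition of the mixed transfer matrices of the first `n` sites. -/
def mixedChain (B : ℕ → Fin d → Matrix (Fin D) (Fin D) ℂ)
    (A : Fin d → Matrix (Fin D) (Fin D) ℂ) : ℕ → Module.End ℂ (Matrix (Fin D) (Fin D) ℂ)
  | 0 => 1
  | n + 1 => mixedTransfer (B n) A * mixedChain B A n

theorem mixedChain_add (B : ℕ → Fin d → Matrix (Fin D) (Fin D) ℂ)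
    (A : Fin d → Matrix (Fin D) (Fin D) ℂ) (n m : ℕ) :
    mixedChain B A (n + m) = mixedChain (fun j => B (j + n)) A m * mixedChain B A n := by
  induction m with
  | zero => rw [add_zero, mixedChain, one_mul]
  | succ m ih => rw [← add_assoc, mixedChain, ih, mixedChain, mul_assoc, add_comm n m]

theorem mixedChain_mul (B : ℕ → Fin d → Matrix (Fin D) (Fin D) ℂ)
    (A : Fin d → Matrix (Fin D) (Fin D) ℂ) {L : ℕ} (hB : ∀ j, B (j + L) = B j) (k : ℕ) :
    mixedChain B A (k * L) = mixedChain B A L ^ k := by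
  induction k with
  | zero => rw [zero_mul, pow_zero, mixedChain]
  | succ k ih => rw [Nat.succ_mul, add_comm, mixedChain_add, pow_succ, ← ih, funext hB]

theorem mixedChain_const (A : Fin d → Matrix (Fin D) (Fin D) ℂ) (n : ℕ) :
    mixedChain (fun _ => A) A n = mixedTransfer A A ^ n := by
  induction n with
  | zero => rfl
  | succ n ih => rw [mixedChain, ih, pow_succ']

theorem mixedChain_eq_sum (B : ℕ → Fin d → Matrix (Fin D) (Fin D) ℂ)
    (A : Fin d → Matrix (Fin D) (Fin D) ℂ) (n : ℕ) :
    mixedChain B A n = ∑ σ : Fin n → Fin d,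
      LinearMap.mulLeft ℂ ((List.ofFn fun i : Fin n => B i (σ i)).prod)ᴴ ∘ₗ
        LinearMap.mulRight ℂ (List.ofFn fun i => A (σ i)).prod := by
  induction n with
  | zero => ext1 X; simp [mixedChain]
  | succ n ih =>
    ext1 X
    rw [mixedChain, ih, Module.End.mul_apply, LinearMap.sum_apply, LinearMap.sum_apply, map_sum,
      ← (Fin.snocEquiv fun _ => Fin d).sum_comp, Fintype.sum_prod_type_right]
    refine Finset.sum_congr rfl fun σ _ => ?_
    rw [mixedTransfer_apply]
    refine Finset.sum_congr rfl fun s _ => ?_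
    simp only [LinearMap.comp_apply, LinearMap.mulLeft_apply, LinearMap.mulRight_apply,
      Fin.snocEquiv, Equiv.coe_fn_mk, List.ofFn_succ', Fin.snoc_castSucc, Fin.snoc_last,
      List.concat_eq_append, List.prod_append, List.prod_singleton, Fin.val_last,
      Fin.val_castSucc, Matrix.conjTranspose_mul, Matrix.mul_assoc]

/-- The trace around the ring is the overlap of the two states; this links the hypothesis on states
to the spectrum of the mixed transfer matrix. -/
theorem trace_mixedChain (B : ℕ → Fin d → Matrix (Fin D) (Fin D) ℂ)
    (A : Fin d → Matrix (Fin D) (Fin D) ℂ) (n : ℕ) :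
    LinearMap.trace ℂ _ (mixedChain B A n) = ∑ σ : Fin n → Fin d,
      star ((List.ofFn fun i : Fin n => B i (σ i)).prod.trace) * mpsState A n σ := by
  rw [mixedChain_eq_sum, map_sum]
  refine Finset.sum_congr rfl fun σ _ => ?_
  rw [trace_mulLeft_comp_mulRight, Matrix.trace_conjTranspose, mpsState]

/-- The tensor `u · A` obtained by acting with `u` on the physical index. -/
def act (u : Matrix (Fin d) (Fin d) ℂ) (A : Fin d → Matrix (Fin D) (Fin D) ℂ) :
    Fin d → Matrix (Fin D) (Fin D) ℂ := fun s => ∑ s', u s s' • A s'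

theorem act_mul (u w : Matrix (Fin d) (Fin d) ℂ) (A : Fin d → Matrix (Fin D) (Fin D) ℂ) :
    act (u * w) A = act u (act w A) := by
  funext s
  simp only [act, Matrix.mul_apply, Finset.sum_smul, Finset.smul_sum, smul_smul]
  exact Finset.sum_comm

theorem act_one (A : Fin d → Matrix (Fin D) (Fin D) ℂ) : act 1 A = A := by
  funext s
  simp [act, Matrix.one_apply]

theorem act_smul_mul_mul (u : Matrix (Fin d) (Fin d) ℂ) (A : Fin d → Matrix (Fin D) (Fin D) ℂ)
    (c : ℂ) (X Y : Matrix (Fin D) (Fin D) ℂ) :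
    act u (fun s => c • (X * A s * Y)) = fun s => c • (X * act u A s * Y) := by
  funext s
  simp only [act, Finset.mul_sum, Finset.sum_mul, Finset.smul_sum]
  refine Finset.sum_congr rfl fun s' _ => ?_
  rw [Matrix.mul_smul, Matrix.smul_mul, smul_comm]

theorem act_left_canonical {u : Matrix (Fin d) (Fin d) ℂ} (hu : u ∈ Matrix.unitaryGroup (Fin d) ℂ)
    {A : Fin d → Matrix (Fin D) (Fin D) ℂ} (hA : ∑ s, (A s)ᴴ * A s = 1) :
    ∑ s, (act u A s)ᴴ * act u A s = 1 := by
  have hu' : ∀ a b, ∑ s, star (u s a) * u s b = if a = b then 1 else 0 := by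
    intro a b
    have h := congrFun (congrFun (Matrix.mem_unitaryGroup_iff'.1 hu) a) b
    rwa [Matrix.mul_apply, Matrix.one_apply] at h
  have h1 : ∀ s, (act u A s)ᴴ * act u A s =
      ∑ a, ∑ b, (star (u s a) * u s b) • ((A a)ᴴ * A b) := by
    intro s
    simp only [act, Matrix.conjTranspose_sum, Matrix.conjTranspose_smul, Finset.sum_mul_sum,
      Matrix.smul_mul, Matrix.mul_smul, smul_smul]
    simp only [mul_comm]
  rw [Finset.sum_congr rfl fun s _ => h1 s, Finset.sum_comm, ← hA]
  refine Finset.sum_congr rfl fun a _ => ?_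
  rw [Finset.sum_comm]
  simp only [← Finset.sum_smul, hu', ite_smul, one_smul, zero_smul, Finset.sum_ite_eq,
    Finset.mem_univ, if_true]

/-- By multilinearity of the matrix product, each site operator can be absorbed into its own tensor.
-/
theorem chainOp_mulVec_mpsState {n : ℕ} (u : Fin n → Matrix (Fin d) (Fin d) ℂ)
    (A : Fin d → Matrix (Fin D) (Fin D) ℂ) (σ : Fin n → Fin d) :
    (chainOp u *ᵥ mpsState A n) σ = (List.ofFn fun i => act (u i) A (σ i)).prod.trace := by
  have h := (MultilinearMap.mkPiAlgebraFin ℂ n (Matrix (Fin D) (Fin D) ℂ)).map_sum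
    (fun i s' => u i (σ i) s' • A s')
  simp only [MultilinearMap.map_smul_univ, MultilinearMap.mkPiAlgebraFin_apply] at h
  simp only [act]
  rw [h, Matrix.trace_sum]
  simp [Matrix.mulVec, dotProduct, chainOp, mpsState]

/-- If the tensors `B` generate the same states as `A` up to a phase, then their mixed transfer
matrix has an eigenvalue outside the open unit disc. -/
theorem exists_hasEigenvalue_mixedChain {A : Fin d → Matrix (Fin D) (Fin D) ℂ}
    (hA : IsInjectiveMPS A) {B : ℕ → Fin d → Matrix (Fin D) (Fin D) ℂ} {L : ℕ} (hL : 1 ≤ L)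
    (hper : ∀ j, B (j + L) = B j)
    (hstate : ∀ k, 1 ≤ k → ∃ c : Circle, ∀ σ : Fin (k * L) → Fin d,
      (List.ofFn fun i : Fin (k * L) => B i (σ i)).prod.trace = (c : ℂ) * mpsState A (k * L) σ) :
    ∃ μ, (mixedChain B A L).HasEigenvalue μ ∧ 1 ≤ ‖μ‖ := by
  -- Proportionality of the states by a phase equates the moduli of the traces. The right side tends
  -- to 1, whereas eigenvalues all inside the disc would force the left side to 0.
  have htr : ∀ k, 1 ≤ k → ‖LinearMap.trace ℂ _ (mixedChain B A L ^ k)‖ =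
      ‖LinearMap.trace ℂ _ (mixedTransfer A A ^ (k * L))‖ := by
    intro k hk
    obtain ⟨c, hc⟩ := hstate k hk
    rw [← mixedChain_mul B A hper, ← mixedChain_const, trace_mixedChain, trace_mixedChain]
    simp only [hc, star_mul', mul_assoc, ← Finset.mul_sum, norm_mul, norm_star, Circle.norm_coe,
      one_mul]
    rfl
  by_contra! hc
  have h0 := (trace_pow_tendsto_zero _ hc).norm
  have h1 := (hA.tendsto_trace_pow.comp (tendsto_id.atTop_mul_const' (show 0 < L from hL))).norm
  have h2 := h1.congr' (f₂ := fun k => ‖LinearMap.trace ℂ _ (mixedChain B A L ^ k)‖) (by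
    filter_upwards [eventually_ge_atTop 1] with k hk using (htr k hk).symm)
  have := tendsto_nhds_unique h0 h2
  simp at this

/-- Fundamental theorem for injective MPS: if site-dependent `L`-periodic tensors generate the
same states as `A` up to a phase, they are related to `A` by unitaries on the bonds. -/
theorem exists_unitary_of_state_eq {A : Fin d → Matrix (Fin D) (Fin D) ℂ}
    (hA : IsInjectiveMPS A) {B : ℕ → Fin d → Matrix (Fin D) (Fin D) ℂ} {L : ℕ} (hL : 1 ≤ L)
    (hB : ∀ j, ∑ s, (B j s)ᴴ * B j s = 1) (hper : ∀ j, B (j + L) = B j)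
    (hstate : ∀ k, 1 ≤ k → ∃ c : Circle, ∀ σ : Fin (k * L) → Fin d,
      (List.ofFn fun i : Fin (k * L) => B i (σ i)).prod.trace = (c : ℂ) * mpsState A (k * L) σ) :
    ∃ v : ℕ → Matrix (Fin D) (Fin D) ℂ, (∀ j, v j ∈ Matrix.unitaryGroup (Fin D) ℂ) ∧
      ∀ j s, B j s = (v j)ᴴ * A s * v (j + 1) := by
  obtain ⟨ρ, hρ, hf⟩ := hA.right_canonical
  obtain ⟨μ, hμ, hμ1⟩ := exists_hasEigenvalue_mixedChain hA hL hper hstate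
  obtain ⟨X₀, hX₀⟩ := hμ.exists_hasEigenvector
  have hw0 : wnorm ρ X₀ ≠ 0 := fun h => hX₀.2 (eq_zero_of_wnorm_eq_zero hρ h)
  obtain ⟨X, hX⟩ : ∃ X : ℕ → Matrix (Fin D) (Fin D) ℂ, ∀ j, X j = mixedChain B A j X₀ :=
    ⟨_, fun _ => rfl⟩
  have hX0 : X 0 = X₀ := hX 0
  have hXs : ∀ j, X (j + 1) = mixedTransfer (B j) A (X j) := fun j => by
    rw [hX, hX, mixedChain, Module.End.mul_apply]
  have hanti : Antitone fun j => wnorm ρ (X j) := antitone_nat_of_succ_le fun j => by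
    rw [hXs]; exact wnorm_mixedTransfer_le hρ hf (hB j) _
  have hXk : ∀ k, X (k * L) = μ ^ k • X₀ := by
    intro k
    rw [hX, mixedChain_mul B A hper, hX₀.pow_apply]
  -- After whole periods the norm is multiplied by `‖μ‖ ^ (2k) ≥ 1`, while it never increases along
  -- the chain; it is therefore constant and every step is an equality case.
  have hge : ∀ k, wnorm ρ X₀ ≤ wnorm ρ (X (k * L)) := by
    intro k
    rw [hXk, wnorm_smul]
    refine le_mul_of_one_le_left (wnorm_nonneg hρ _) ?_
    rw [← Complex.ofReal_one, Complex.real_le_real, norm_pow]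
    exact one_le_pow₀ (one_le_pow₀ hμ1)
  have hconst : ∀ j, wnorm ρ (X j) = wnorm ρ X₀ := fun j =>
    le_antisymm (hX0 ▸ hanti (Nat.zero_le j)) ((hge j).trans (hanti (Nat.le_mul_of_pos_right j hL)))
  have hint : ∀ j s, X j * A s = B j s * X (j + 1) := fun j s => by
    have h := intertwine_of_wnorm_eq hρ hf (hB j) (X := X j) (by rw [← hXs, hconst, hconst]) s
    rwa [← hXs] at h
  have hM : ∀ j, (mixedTransfer A A ^ j) (X₀ᴴ * X₀) = (X j)ᴴ * X j := by
    intro j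
    induction j with
    | zero => rw [pow_zero, Module.End.one_apply, hX0]
    | succ j ih =>
      rw [pow_succ', Module.End.mul_apply, ih,
        conjTranspose_mul_self_mixedTransfer (hB j) (hint j)]
  have hnorm : ‖μ‖ ^ 2 = 1 := by
    have h := hconst (1 * L)
    rw [hXk, wnorm_smul, pow_one] at h
    exact_mod_cast mul_right_cancel₀ hw0 (h.trans (one_mul _).symm)
  -- One period multiplies the Gram matrix by `‖μ‖² = 1`, so it is fixed by the `L`-th power of the
  -- transfer matrix and is scalar. Rescaling by the root of this scalar gives unitaries.
  obtain ⟨a, ha⟩ := hA.eq_smul_one_of_pow_fixed (X := X₀ᴴ * X₀) hL (by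
    rw [hM, ← one_mul L, hXk, pow_one, Matrix.conjTranspose_smul, Matrix.smul_mul,
      Matrix.mul_smul, smul_smul, mul_comm]
    have : μ * star μ = 1 := by
      rw [Complex.star_def, Complex.mul_conj', ← Complex.ofReal_pow, hnorm, Complex.ofReal_one]
    rw [this, one_smul])
  have haj : ∀ j, (X j)ᴴ * X j = a • 1 := by
    intro j
    rw [← hM, ha, map_smul]
    congr 1
    induction j with
    | zero => rw [pow_zero, Module.End.one_apply]
    | succ j ih => rw [pow_succ, Module.End.mul_apply, hA.mixedTransfer_one, ih]
  have ha0 : a ≠ 0 := by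
    rintro rfl
    rw [zero_smul, Matrix.conjTranspose_mul_self_eq_zero] at ha
    exact hX₀.2 ha
  have hapos : 0 ≤ a := by
    have h := (Matrix.posSemidef_conjTranspose_mul_self X₀).diag_nonneg (i := ⟨0, hA.bond_pos⟩)
    rw [ha] at h
    simpa using h
  obtain ⟨r, hr, rfl⟩ : ∃ r : ℝ, 0 < r ∧ (r : ℂ) = a := by
    have h := Complex.nonneg_iff.1 hapos
    have hre : ((a.re : ℝ) : ℂ) = a := Complex.ext rfl (by simpa using h.2)
    refine ⟨a.re, lt_of_le_of_ne h.1 fun h0 => ha0 ?_, hre⟩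
    rw [← hre, ← h0, Complex.ofReal_zero]
  have hs : ((√r)⁻¹ : ℂ) * (√r)⁻¹ * r = 1 := by
    rw [← Complex.ofReal_inv, ← Complex.ofReal_mul, ← Complex.ofReal_mul, ← Complex.ofReal_one]
    congr 1
    rw [← mul_inv, Real.mul_self_sqrt hr.le, inv_mul_cancel₀ hr.ne']
  have hv : ∀ j, ((√r)⁻¹ : ℂ) • (X j)ᴴ ∈ Matrix.unitaryGroup (Fin D) ℂ := by
    intro j
    rw [Matrix.mem_unitaryGroup_iff, Matrix.star_eq_conjTranspose, Matrix.conjTranspose_smul,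
      Matrix.conjTranspose_conjTranspose, Matrix.smul_mul, Matrix.mul_smul, smul_smul, haj,
      smul_smul]
    have : star ((√r)⁻¹ : ℂ) = (√r)⁻¹ := by simp
    rw [this, hs, one_smul]
  refine ⟨fun j => ((√r)⁻¹ : ℂ) • (X j)ᴴ, hv, fun j s => ?_⟩
  have h1 := Matrix.mem_unitaryGroup_iff'.1 (hv (j + 1))
  rw [Matrix.star_eq_conjTranspose] at h1
  have h2 : ∀ i, (((√r)⁻¹ : ℂ) • (X i)ᴴ)ᴴ = ((√r)⁻¹ : ℂ) • X i := by
    intro i; simp [Matrix.conjTranspose_smul]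
  calc B j s = B j s * ((((√r)⁻¹ : ℂ) • (X (j + 1))ᴴ)ᴴ * (((√r)⁻¹ : ℂ) • (X (j + 1))ᴴ)) := by
        rw [h1, mul_one]
    _ = _ := by
        rw [← mul_assoc, h2, h2, Matrix.mul_smul (B j s), ← hint, ← Matrix.smul_mul]

end Chain

/-! ### Equality up to a phase -/

section PhaseEq

variable {D : ℕ} {X Y Z X' Y' : Matrix (Fin D) (Fin D) ℂ}

theorem PhaseEq.refl (X : Matrix (Fin D) (Fin D) ℂ) : PhaseEq X X := ⟨1, by simp⟩

theorem PhaseEq.symm : PhaseEq X Y → PhaseEq Y X := by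
  rintro ⟨c, rfl⟩
  refine ⟨c⁻¹, ?_⟩
  rw [smul_smul, ← Circle.coe_mul, inv_mul_cancel, Circle.coe_one, one_smul]

theorem PhaseEq.trans : PhaseEq X Y → PhaseEq Y Z → PhaseEq X Z := by
  rintro ⟨c, rfl⟩ ⟨c', rfl⟩
  exact ⟨c * c', by rw [smul_smul, Circle.coe_mul]⟩

theorem PhaseEq.mul : PhaseEq X Y → PhaseEq X' Y' → PhaseEq (X * X') (Y * Y') := by
  rintro ⟨c, rfl⟩ ⟨c', rfl⟩
  exact ⟨c * c', by rw [Matrix.smul_mul, Matrix.mul_smul, smul_smul, Circle.coe_mul]⟩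

theorem conjTranspose_mul_self_of_mem {u : Matrix (Fin D) (Fin D) ℂ}
    (hu : u ∈ Matrix.unitaryGroup (Fin D) ℂ) : uᴴ * u = 1 :=
  Matrix.mem_unitaryGroup_iff'.1 hu

theorem mul_conjTranspose_self_of_mem {u : Matrix (Fin D) (Fin D) ℂ}
    (hu : u ∈ Matrix.unitaryGroup (Fin D) ℂ) : u * uᴴ = 1 :=
  Matrix.mem_unitaryGroup_iff.1 hu

theorem commutator_eq_smul_one (hX : X ∈ Matrix.unitaryGroup (Fin D) ℂ)
    (hY : Y ∈ Matrix.unitaryGroup (Fin D) ℂ) {q : ℂ} (h : X * Y = q • (Y * X)) :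
    X * Y * Xᴴ * Yᴴ = q • 1 := by
  rw [h, Matrix.smul_mul, Matrix.smul_mul, Matrix.mul_assoc Y,
    mul_conjTranspose_self_of_mem hX, mul_one, mul_conjTranspose_self_of_mem hY]

theorem smul_right_cancel_of_mem (hD : 0 < D) (hX : X ∈ Matrix.unitaryGroup (Fin D) ℂ) {p q : ℂ}
    (h : p • X = q • X) : p = q := by
  have : Nonempty (Fin D) := ⟨⟨0, hD⟩⟩
  have h1 := congrArg (· * Xᴴ) h
  simp only [Matrix.smul_mul, mul_conjTranspose_self_of_mem hX] at h1
  exact smul_left_injective ℂ (one_ne_zero (α := Matrix (Fin D) (Fin D) ℂ)) h1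

theorem pow_mul_pow_of_mul_eq_smul {q : ℂ} (h : X * Y = q • (Y * X)) (m n : ℕ) :
    X ^ m * Y ^ n = q ^ (m * n) • (Y ^ n * X ^ m) := by
  have h1 : ∀ m, X ^ m * Y = q ^ m • (Y * X ^ m) := by
    intro m
    induction m with
    | zero => simp
    | succ m ih =>
      rw [pow_succ X, Matrix.mul_assoc, h, Matrix.mul_smul, ← Matrix.mul_assoc, ih,
        Matrix.smul_mul, smul_smul, pow_succ' q, Matrix.mul_assoc]
  induction n with
  | zero => simp
  | succ n ih =>
    rw [pow_succ Y, ← Matrix.mul_assoc, ih, Matrix.smul_mul, Matrix.mul_assoc, h1, Matrix.mul_smul,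
      smul_smul, ← pow_add, Matrix.mul_assoc, mul_add, mul_one]

end PhaseEq

/-! ### Pushing on-site operators to the bonds -/

section Push

variable {d D : ℕ}

/-- The site operator `u` is pushed through the tensor `A`: `u · A ≐ p† A q`. -/
def PushSite (u : Matrix (Fin d) (Fin d) ℂ) (A : Fin d → Matrix (Fin D) (Fin D) ℂ)
    (p q : Matrix (Fin D) (Fin D) ℂ) : Prop :=
  ∃ c : Circle, act u A = fun s => (c : ℂ) • (pᴴ * A s * q)

namespace PushSite

variable {u u' : Matrix (Fin d) (Fin d) ℂ} {A : Fin d → Matrix (Fin D) (Fin D) ℂ}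
  {p q p' q' : Matrix (Fin D) (Fin D) ℂ}

theorem mul (h : PushSite u A p q) (h' : PushSite u' A p' q') :
    PushSite (u * u') A (p * p') (q * q') := by
  obtain ⟨c, hc⟩ := h
  obtain ⟨c', hc'⟩ := h'
  refine ⟨c' * c, ?_⟩
  rw [act_mul, hc', act_smul_mul_mul, hc]
  funext s
  rw [Matrix.mul_smul, Matrix.smul_mul, smul_smul, Circle.coe_mul, Matrix.conjTranspose_mul]
  simp only [Matrix.mul_assoc]

theorem pow (h : PushSite u A p q) (n : ℕ) : PushSite (u ^ n) A (p ^ n) (q ^ n) := by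
  induction n with
  | zero => exact ⟨1, by simp [act_one]⟩
  | succ n ih => simpa only [pow_succ] using ih.mul h

theorem congr_right (h : PushSite u A p q) (hq : PhaseEq q q') : PushSite u A p q' := by
  obtain ⟨c, hc⟩ := h
  obtain ⟨c', rfl⟩ := hq
  refine ⟨c * c', ?_⟩
  simp only [hc, Matrix.mul_smul, smul_smul, Circle.coe_mul]

theorem of_mul_eq (hp : p ∈ Matrix.unitaryGroup (Fin D) ℂ) (c : Circle)
    (h : ∀ s, p * act u A s = (c : ℂ) • (A s * q)) : PushSite u A p q := by
  refine ⟨c, funext fun s => ?_⟩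
  rw [Matrix.mul_assoc, ← Matrix.mul_smul, ← h, ← Matrix.mul_assoc,
    conjTranspose_mul_self_of_mem hp, one_mul]

end PushSite

/-- The unitaries `v j` push the site operators `W j` through the tensor `A`:
`W_j · A ≐ v_j† A v_{j+1}`. -/
structure IsPush (W : ℕ → Matrix (Fin d) (Fin d) ℂ) (A : Fin d → Matrix (Fin D) (Fin D) ℂ)
    (v : ℕ → Matrix (Fin D) (Fin D) ℂ) : Prop where
  unitary : ∀ j, v j ∈ Matrix.unitaryGroup (Fin D) ℂ
  push : ∀ j, PushSite (W j) A (v j) (v (j + 1))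

namespace IsPush

variable {W W' : ℕ → Matrix (Fin d) (Fin d) ℂ} {A : Fin d → Matrix (Fin D) (Fin D) ℂ}
  {v v' : ℕ → Matrix (Fin D) (Fin D) ℂ}

theorem mul (h : IsPush W A v) (h' : IsPush W' A v') :
    IsPush (fun j => W j * W' j) A (fun j => v j * v' j) where
  unitary j := mul_mem (h.unitary j) (h'.unitary j)
  push j := (h.push j).mul (h'.push j)

theorem pow (h : IsPush W A v) (n : ℕ) : IsPush (fun j => W j ^ n) A (fun j => v j ^ n) where
  unitary j := pow_mem (h.unitary j) n
  push j := (h.push j).pow n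

theorem shift (h : IsPush W A v) (n : ℕ) :
    IsPush (fun j => W (j + n)) A (fun j => v (j + n)) where
  unitary j := h.unitary (j + n)
  push j := by
    obtain ⟨c, hc⟩ := h.push (j + n)
    refine ⟨c, hc.trans ?_⟩
    rw [add_right_comm]

/-- The tensors transformed at the first `n` sites multiply to the transformed product. -/
theorem prod_act (h : IsPush W A v) (n : ℕ) : ∃ c : Circle, ∀ σ : Fin n → Fin d,
    (List.ofFn fun i : Fin n => act (W i) A (σ i)).prod =
      (c : ℂ) • ((v 0)ᴴ * (List.ofFn fun i => A (σ i)).prod * v n) := by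
  induction n with
  | zero =>
    refine ⟨1, fun σ => ?_⟩
    simp [conjTranspose_mul_self_of_mem (h.unitary 0)]
  | succ n ih =>
    obtain ⟨c, hc⟩ := ih
    obtain ⟨c', hc'⟩ := h.push n
    refine ⟨c * c', fun σ => ?_⟩
    have h2 := hc fun i => σ i.castSucc
    simp only [List.ofFn_succ', List.concat_eq_append, List.prod_append, List.prod_singleton,
      Fin.val_last, Fin.val_castSucc]
    rw [h2, hc', Matrix.smul_mul, Matrix.mul_smul, smul_smul, Circle.coe_mul]
    congr 1
    calc _ = (v 0)ᴴ * (List.ofFn fun i : Fin n => A (σ i.castSucc)).prod *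
          (v n * (v n)ᴴ) * A (σ (Fin.last n)) * v (n + 1) := by simp only [Matrix.mul_assoc]
      _ = _ := by
        rw [mul_conjTranspose_self_of_mem (h.unitary n), mul_one]
        simp only [Matrix.mul_assoc]

end IsPush

theorem continuous_wnorm (ρ : Matrix (Fin D) (Fin D) ℂ) : Continuous (wnorm ρ) :=
  (continuous_const.matrix_mul
    (continuous_id.matrix_conjTranspose.matrix_mul continuous_id)).matrix_trace

theorem wnorm_of_mem (ρ : Matrix (Fin D) (Fin D) ℂ) {u : Matrix (Fin D) (Fin D) ℂ}
    (hu : u ∈ Matrix.unitaryGroup (Fin D) ℂ) : wnorm ρ u = ρ.trace := by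
  rw [wnorm, conjTranspose_mul_self_of_mem hu, mul_one]

/-- A unitary whose `ρ`-average has modulus one is a phase. -/
theorem phaseEq_one_of_wnorm {A : Fin d → Matrix (Fin D) (Fin D) ℂ} (hA : IsInjectiveMPS A)
    {ρ w : Matrix (Fin D) (Fin D) ℂ} (hρ : ρ.PosDef) (hw : w ∈ Matrix.unitaryGroup (Fin D) ℂ)
    (h : wnorm ρ (IsInjectiveMPS.meanProj ρ w) = ρ.trace) :
    PhaseEq w 1 := by
  have ht := hA.trace_pos hρ
  set p : ℂ := (ρ.trace)⁻¹ * (ρ * w).trace with hp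
  have hp1 : (ρ * w).trace = p * ρ.trace := by
    rw [hp, mul_comm, mul_inv_cancel_left₀ ht]
  have hp2 : (ρ * wᴴ).trace = star p * ρ.trace := by
    have hs : star ρ.trace = ρ.trace := by rw [← Matrix.trace_conjTranspose, hρ.1.eq]
    rw [← hs, ← star_mul', ← hp1, ← Matrix.trace_conjTranspose, Matrix.conjTranspose_mul, hρ.1.eq,
      Matrix.trace_mul_comm]
  rw [IsInjectiveMPS.meanProj_apply, ← hp, wnorm_smul, wnorm_of_mem ρ (one_mem _)] at h
  have hn : ((‖p‖ ^ 2 : ℝ) : ℂ) = 1 := mul_right_cancel₀ ht (h.trans (one_mul _).symm)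
  have hpp : p * star p = 1 := by
    rw [Complex.star_def, Complex.mul_conj', ← Complex.ofReal_pow, hn]
  -- Equality case of Cauchy-Schwarz: when the mean `p` of the unitary `w` has modulus 1, the
  -- variance of `w` about `p` is zero.
  have h0 : wnorm ρ (w - p • 1) = 0 := by
    have e : (w - p • (1 : Matrix (Fin D) (Fin D) ℂ))ᴴ * (w - p • 1) =
        1 - p • wᴴ - star p • w + (p * star p) • 1 := by
      rw [Matrix.conjTranspose_sub, Matrix.conjTranspose_smul, Matrix.conjTranspose_one, sub_mul,
        mul_sub, mul_sub, conjTranspose_mul_self_of_mem hw, Matrix.mul_smul, mul_one,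
        Matrix.smul_mul, one_mul, Matrix.smul_mul, one_mul, smul_smul, mul_comm p]
      abel
    rw [wnorm, e, hpp, mul_add, mul_sub, mul_sub, Matrix.trace_add, Matrix.trace_sub,
      Matrix.trace_sub, Matrix.mul_smul, Matrix.mul_smul, Matrix.trace_smul, Matrix.trace_smul,
      hp1, hp2, one_smul, mul_one, smul_eq_mul, smul_eq_mul, ← mul_assoc, ← mul_assoc,
      mul_comm (star p), hpp]
    ring
  have hpn : ‖p‖ = 1 := by
    have : ‖p‖ ^ 2 = 1 := by exact_mod_cast hn
    exact (pow_eq_one_iff_of_nonneg (norm_nonneg _) two_ne_zero).1 this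
  exact ⟨⟨p, mem_sphere_zero_iff_norm.2 hpn⟩,
    sub_eq_zero.1 (eq_zero_of_wnorm_eq_zero hρ h0)⟩

/-- The bond unitaries of an injective MPS are unique up to phases. -/
theorem IsPush.phaseEq {W : ℕ → Matrix (Fin d) (Fin d) ℂ}
    {A : Fin d → Matrix (Fin D) (Fin D) ℂ} {v v' : ℕ → Matrix (Fin D) (Fin D) ℂ}
    (hA : IsInjectiveMPS A) (h : IsPush W A v) (h' : IsPush W A v') (j : ℕ) :
    PhaseEq (v' j) (v j) := by
  -- Discarding the sites to the left of bond `j` reduces to bond 0; no periodicity is needed.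
  suffices H : ∀ {W : ℕ → Matrix (Fin d) (Fin d) ℂ} {v v' : ℕ → Matrix (Fin D) (Fin D) ℂ},
      IsPush W A v → IsPush W A v' → PhaseEq (v' 0) (v 0) by
    simpa using H (h.shift j) (h'.shift j)
  clear h h' v v' W
  intro W v v' h h'
  obtain ⟨ρ, hρ, hf⟩ := hA.right_canonical
  have hw : ∀ j, v' j * (v j)ᴴ ∈ Matrix.unitaryGroup (Fin D) ℂ := fun j =>
    mul_mem (h'.unitary j) (Unitary.star_mem (h.unitary j))
  have hE : ∀ j, PhaseEq (mixedTransfer A A (v' j * (v j)ᴴ)) (v' (j + 1) * (v (j + 1))ᴴ) := by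
    intro j
    obtain ⟨c, hc⟩ := h.push j
    obtain ⟨c', hc'⟩ := h'.push j
    refine ⟨c⁻¹ * c', ?_⟩
    have hs : ∀ s, v' j * (v j)ᴴ * A s = ((c⁻¹ * c' : Circle) : ℂ) •
        (A s * (v' (j + 1) * (v (j + 1))ᴴ)) := by
      intro s
      have e := congrFun (hc.symm.trans hc') s
      have e1 : (v j)ᴴ * A s * v (j + 1) =
          ((c⁻¹ * c' : Circle) : ℂ) • ((v' j)ᴴ * A s * v' (j + 1)) := by
        rw [Circle.coe_mul, mul_smul, ← e, smul_smul, ← Circle.coe_mul, inv_mul_cancel,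
          Circle.coe_one, one_smul]
      calc v' j * (v j)ᴴ * A s = v' j * ((v j)ᴴ * A s * v (j + 1)) * (v (j + 1))ᴴ := by
            simp only [Matrix.mul_assoc, mul_conjTranspose_self_of_mem (h.unitary (j + 1)), mul_one]
        _ = ((c⁻¹ * c' : Circle) : ℂ) • ((v' j * (v' j)ᴴ) *
              (A s * (v' (j + 1) * (v (j + 1))ᴴ))) := by
            rw [e1, Matrix.mul_smul, Matrix.smul_mul]
            simp only [Matrix.mul_assoc]
        _ = _ := by rw [mul_conjTranspose_self_of_mem (h'.unitary j), one_mul]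
    rw [mixedTransfer_apply]
    simp only [Matrix.mul_assoc] at hs ⊢
    simp only [hs, Matrix.mul_smul, ← Finset.smul_sum]
    simp only [← Matrix.mul_assoc, ← Finset.sum_mul, hA.left_canonical, one_mul]
  have hpow : ∀ j, PhaseEq ((mixedTransfer A A ^ j) (v' 0 * (v 0)ᴴ)) (v' j * (v j)ᴴ) := by
    intro j
    induction j with
    | zero => rw [pow_zero, Module.End.one_apply]; exact PhaseEq.refl _
    | succ j ih =>
      obtain ⟨c, hc⟩ := ih
      rw [pow_succ', Module.End.mul_apply, hc, map_smul]
      exact PhaseEq.trans ⟨c, rfl⟩ (hE j)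
  have hlim := ((continuous_wnorm ρ).tendsto _).comp
    (hA.tendsto_pow_apply hρ hf (v' 0 * (v 0)ᴴ))
  -- The whole orbit consists of unitaries up to phases, so the limit, the mean of `v' 0 * (v 0)ᴴ`,
  -- has the same weighted norm `tr ρ`.
  have hconst : ∀ j, wnorm ρ ((mixedTransfer A A ^ j) (v' 0 * (v 0)ᴴ)) = ρ.trace := by
    intro j
    obtain ⟨c, hc⟩ := hpow j
    rw [hc, wnorm_smul, wnorm_of_mem ρ (hw j), Circle.norm_coe]
    simp
  obtain ⟨c, hc⟩ := phaseEq_one_of_wnorm hA hρ (hw 0)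
    (tendsto_nhds_unique hlim (tendsto_const_nhds.congr fun j => (hconst j).symm))
  refine ⟨c, ?_⟩
  calc v' 0 = v' 0 * (v 0)ᴴ * v 0 := by
        rw [Matrix.mul_assoc, conjTranspose_mul_self_of_mem (h.unitary 0), mul_one]
    _ = _ := by rw [hc, Matrix.smul_mul, one_mul]

end Push

/-! ### The on-site operators of the modulated symmetries -/

section OnSite

variable {d N : ℕ} {U : Matrix (Fin d) (Fin d) ℂ}

theorem onSite_eq_pow (N b : ℕ) (U : Matrix (Fin d) (Fin d) ℂ) (g : G N) (j : ℕ) :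
    onSite N b U g j = U ^ (g.1.val * expMod b j + g.2.val * dipExpMod b j) := by
  rw [onSite, ← pow_mul, ← pow_mul, pow_add]

theorem onSite_mem (hU : U ∈ Matrix.unitaryGroup (Fin d) ℂ) (b : ℕ) (g : G N) (j : ℕ) :
    onSite N b U g j ∈ Matrix.unitaryGroup (Fin d) ℂ := by
  rw [onSite_eq_pow]
  exact pow_mem hU _

theorem onSite_add [NeZero N] (hU : U ^ N = 1) (b : ℕ) (g h : G N) (j : ℕ) :
    onSite N b U (g + h) j = onSite N b U g j * onSite N b U h j := by
  have e : ∀ a c : ZMod N, U ^ (a + c).val = U ^ a.val * U ^ c.val := by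
    intro a c
    rw [ZMod.val_add, ← pow_add, pow_eq_pow_mod (a.val + c.val) hU]
  have hcomm : ∀ m n : ℕ, Commute (U ^ m) (U ^ n) := fun m n => Commute.pow_pow_self U m n
  simp only [onSite, Prod.fst_add, Prod.snd_add, e, (hcomm _ _).mul_pow]
  rw [mul_assoc, mul_assoc, ← mul_assoc ((U ^ h.1.val) ^ expMod b j),
    (((hcomm h.1.val g.2.val).pow_pow (expMod b j) (dipExpMod b j))).eq, mul_assoc]

theorem onSite_periodic {b L : ℕ} (h₁ : WellDefinedOnRing U (expMod b) L)
    (h₂ : WellDefinedOnRing U (dipExpMod b) L) (g : G N) (j : ℕ) :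
    onSite N b U g (j + L + 1) = onSite N b U g (j + 1) := by
  have e₁ := h₁ (j + 1) (Nat.le_add_left 1 j)
  have e₂ := h₂ (j + 1) (Nat.le_add_left 1 j)
  rw [add_right_comm j L 1, onSite, onSite, ← pow_mul, ← pow_mul, ← pow_mul, ← pow_mul,
    mul_comm g.1.val, mul_comm g.1.val, mul_comm g.2.val, mul_comm g.2.val, pow_mul U, pow_mul U,
    pow_mul U, pow_mul U, e₁, e₂]

theorem onSite_mod {b L : ℕ} (h₁ : WellDefinedOnRing U (expMod b) L)
    (h₂ : WellDefinedOnRing U (dipExpMod b) L) (g : G N) (i : ℕ) :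
    onSite N b U g (i % L + 1) = onSite N b U g (i + 1) := by
  have h : Function.Periodic (fun j => onSite N b U g (j + 1)) L :=
    fun j => onSite_periodic h₁ h₂ g j
  exact h.map_mod_nat i

theorem onSite_exp_succ (b : ℕ) (U : Matrix (Fin d) (Fin d) ℂ) (g : ZMod N) (j : ℕ) :
    onSite N b U (g, 0) (j + 2) = onSite N b U (g, 0) (j + 1) ^ b := by
  simp only [onSite_eq_pow, ZMod.val_zero, zero_mul, add_zero, expMod, ← pow_mul,
    Nat.add_sub_cancel]
  congr 1
  rw [show j + 2 - 1 = j + 1 from rfl, pow_succ, mul_assoc]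

/-- The exponents satisfy `(j+2)b^(j+1) = b·(j+1)b^j + b^(j+1)`; the extra summand is what makes the
dipole recursion involve the exponential symmetry. -/
theorem onSite_dip_succ (b : ℕ) (U : Matrix (Fin d) (Fin d) ℂ) (g : ZMod N) (j : ℕ) :
    onSite N b U (0, g) (j + 2) =
      onSite N b U (0, g) (j + 1) ^ b * onSite N b U (g, 0) (j + 2) := by
  simp only [onSite_eq_pow, ZMod.val_zero, zero_mul, add_zero, zero_add, expMod, dipExpMod,
    ← pow_mul, Nat.add_sub_cancel, ← pow_add]
  congr 1
  rw [show j + 2 - 1 = j + 1 from rfl]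
  ring

theorem wellDefinedOnRing_iff {b L : ℕ} (hU : U ∈ Matrix.unitaryGroup (Fin d) ℂ)
    (ho : orderOf U = N) :
    (WellDefinedOnRing U (expMod b) L ∧ WellDefinedOnRing U (dipExpMod b) L) ↔
      (L ≡ 0 [MOD N] ∧ b ^ L ≡ 1 [MOD N]) := by
  have hunit : IsUnit U := ⟨⟨U, star U, Matrix.mem_unitaryGroup_iff.1 hU,
    Matrix.mem_unitaryGroup_iff'.1 hU⟩, rfl⟩
  have key : ∀ m n : ℕ, U ^ m = U ^ n ↔ m ≡ n [MOD N] := by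
    obtain ⟨u, rfl⟩ := hunit
    intro m n
    rw [← Units.val_pow_eq_pow_val, ← Units.val_pow_eq_pow_val, Units.val_inj,
      pow_eq_pow_iff_modEq, ← ho, orderOf_units]
  simp only [WellDefinedOnRing, key, expMod, dipExpMod]
  constructor
  · rintro ⟨h₁, h₂⟩
    -- Site `j = 1` alone yields both congruences.
    have e₁ : b ^ L ≡ 1 [MOD N] := by simpa using h₁ 1 le_rfl
    have e₂ : (1 + L) * b ^ L ≡ 1 [MOD N] := by simpa using h₂ 1 le_rfl
    have e₃ : 1 + L ≡ 1 + 0 [MOD N] := by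
      simpa using ((Nat.ModEq.refl (1 + L)).mul e₁).symm.trans e₂
    exact ⟨e₃.add_left_cancel' 1, e₁⟩
  · rintro ⟨h₁, h₂⟩
    have e : ∀ j, 1 ≤ j → b ^ (j + L - 1) ≡ b ^ (j - 1) [MOD N] := by
      intro j hj
      rw [show j + L - 1 = j - 1 + L by omega, pow_add]
      simpa using (Nat.ModEq.refl (b ^ (j - 1))).mul h₂
    exact ⟨e, fun j hj => by simpa using ((Nat.ModEq.refl j).add h₁).mul (e j hj)⟩

end OnSite

/-! ### Bond unitaries of symmetric MPS -/

section Bond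

variable {d D N b L : ℕ} {U : Matrix (Fin d) (Fin d) ℂ} {A : Fin d → Matrix (Fin D) (Fin D) ℂ}

theorem isBondUnitaries_iff {v : ℕ → G N → Matrix (Fin D) (Fin D) ℂ} :
    IsBondUnitaries N b U A v ↔
      ∀ g, IsPush (fun j => onSite N b U g (j + 1)) A (fun j => v j g) := by
  constructor
  · refine fun h g => ⟨fun j => h.unitary j g, fun j => ?_⟩
    obtain ⟨c, hc⟩ := h.push j g
    exact ⟨c, funext hc⟩
  · refine fun h => ⟨fun j g => (h g).unitary j, fun j g => ?_⟩
    obtain ⟨c, hc⟩ := (h g).push j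
    exact ⟨c, congrFun hc⟩

theorem IsSymmetricMPS.exists_bondUnitaries (h : IsSymmetricMPS N b L U A) (hL : 1 ≤ L) :
    ∃ v, IsBondUnitaries N b U A v := by
  have hg : ∀ g : G N, ∃ v : ℕ → Matrix (Fin D) (Fin D) ℂ,
      IsPush (fun j => onSite N b U g (j + 1)) A v := by
    intro g
    obtain ⟨v, hv, hp⟩ := exists_unitary_of_state_eq h.injective
      (B := fun j => act (onSite N b U g (j + 1)) A) hL
      (fun j => act_left_canonical (onSite_mem h.unitary b g _) h.injective.left_canonical)
      (fun j => by rw [onSite_periodic h.ring_exp h.ring_dipExp]) (by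
        intro k hk
        obtain ⟨c, hc⟩ := h.symmetric g k hk
        refine ⟨c, fun σ => ?_⟩
        have e := congrFun hc σ
        rw [symOp, chainOp_mulVec_mpsState] at e
        simpa only [onSite_mod h.ring_exp h.ring_dipExp, Pi.smul_apply, smul_eq_mul] using e)
    exact ⟨v, hv, fun j => ⟨1, funext fun s => by rw [hp, Circle.coe_one, one_smul]⟩⟩
  choose v hv using hg
  exact ⟨fun j g => v g j, isBondUnitaries_iff.2 hv⟩

namespace IsBondUnitaries

variable {v : ℕ → G N → Matrix (Fin D) (Fin D) ℂ}

/-- Shifting the chain by one site and taking `b`-th powers produce the same site operators, so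
uniqueness identifies the two systems of bond unitaries. The dipole recursion and `phaseEq_mul`
follow in the same way. -/
theorem vE_succ (hA : IsInjectiveMPS A) (hv : IsBondUnitaries N b U A v) (j : ℕ) (g : ZMod N) :
    PhaseEq (vE v (j + 1) g) (vE v j g ^ b) := by
  have h := isBondUnitaries_iff.1 hv (g, 0)
  have h₁ := h.shift 1
  simp only [onSite_exp_succ, add_assoc, one_add_one_eq_two] at h₁
  exact (h.pow b).phaseEq hA h₁ j

theorem vDE_succ (hA : IsInjectiveMPS A) (hv : IsBondUnitaries N b U A v) (j : ℕ) (g : ZMod N) :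
    PhaseEq (vDE v (j + 1) g) (vDE v j g ^ b * vE v (j + 1) g) := by
  have h := isBondUnitaries_iff.1 hv (0, g)
  have h₁ := h.shift 1
  have h₂ := (isBondUnitaries_iff.1 hv (g, 0)).shift 1
  simp only [add_assoc, one_add_one_eq_two] at h₁ h₂
  simp only [onSite_dip_succ] at h₁
  exact ((h.pow b).mul h₂).phaseEq hA h₁ j

theorem vDE_succ' (hA : IsInjectiveMPS A) (hv : IsBondUnitaries N b U A v) (j : ℕ)
    (g : ZMod N) : PhaseEq (vDE v (j + 1) g) (vDE v j g ^ b * vE v j g ^ b) :=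
  (hv.vDE_succ hA j g).trans ((PhaseEq.refl _).mul (hv.vE_succ hA j g))

theorem phaseEq_mul [NeZero N] (hU : U ^ N = 1) (hA : IsInjectiveMPS A)
    (hv : IsBondUnitaries N b U A v) (j : ℕ) (g h : G N) :
    PhaseEq (v j g * v j h) (v j (g + h)) := by
  have h₁ := isBondUnitaries_iff.1 hv (g + h)
  simp only [onSite_add hU] at h₁
  exact h₁.phaseEq hA ((isBondUnitaries_iff.1 hv g).mul (isBondUnitaries_iff.1 hv h)) j

end IsBondUnitaries

/-- `u` is a projective representation with cocycle `ω`. -/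
def IsProjRep {H : Type*} [AddCommGroup H] (u : H → Matrix (Fin D) (Fin D) ℂ) (ω : Z2 H) : Prop :=
  ∀ g h, u g * u h = (ω.1 g h : ℂ) • u (g + h)

theorem circle_smul_cancel {X : Matrix (Fin D) (Fin D) ℂ} (hX : X ≠ 0) {a c : Circle}
    (h : (a : ℂ) • X = (c : ℂ) • X) : a = c :=
  Circle.ext (smul_left_injective ℂ hX h)

theorem ne_zero_of_mem (hD : 0 < D) {X : Matrix (Fin D) (Fin D) ℂ}
    (hX : X ∈ Matrix.unitaryGroup (Fin D) ℂ) : X ≠ 0 := by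
  have : Nonempty (Fin D) := ⟨⟨0, hD⟩⟩
  rintro rfl
  have h := mul_conjTranspose_self_of_mem hX
  rw [zero_mul] at h
  exact zero_ne_one h

/-! ### Projective representations and their cohomology classes -/

section ProjRep

variable {H : Type*} [AddCommGroup H] {u u' : H → Matrix (Fin D) (Fin D) ℂ}

/-- Associativity of the matrix product is the cocycle identity. -/
theorem exists_isProjRep (hD : 0 < D) (hu : ∀ g, u g ∈ Matrix.unitaryGroup (Fin D) ℂ)
    (hm : ∀ g h, PhaseEq (u g * u h) (u (g + h))) : ∃ ω, IsProjRep u ω := by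
  choose ω hω using hm
  refine ⟨⟨ω, fun g h l => ?_⟩, hω⟩
  refine circle_smul_cancel (ne_zero_of_mem hD (hu (g + h + l))) ?_
  rw [Circle.coe_mul, Circle.coe_mul, mul_smul, mul_smul, ← hω, ← Matrix.smul_mul, ← hω,
    Matrix.mul_assoc, hω h l, Matrix.mul_smul, hω g, add_assoc]

theorem IsProjRep.mk_eq_of_phaseEq (hD : 0 < D)
    (hu : ∀ g, u g ∈ Matrix.unitaryGroup (Fin D) ℂ) {ω ω' : Z2 H} (h : IsProjRep u ω)
    (h' : IsProjRep u' ω') (hp : ∀ g, PhaseEq (u' g) (u g)) : H2.mk ω = H2.mk ω' := by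
  choose β hβ using hp
  refine (H2.mk_eq_mk_iff ω ω').2 ⟨β, fun g k => ?_⟩
  rw [← mul_assoc, eq_mul_inv_iff_mul_eq]
  refine circle_smul_cancel (ne_zero_of_mem hD (hu (g + k))) ?_
  have e := h' g k
  rw [hβ g, hβ k, hβ (g + k), Matrix.smul_mul, Matrix.mul_smul, h g k] at e
  simp only [smul_smul, ← Circle.coe_mul] at e
  rw [← e]
  congr 2
  ac_rfl

theorem IsProjRep.mul_eq_smul [NeZero N] {u : G N → Matrix (Fin D) (Fin D) ℂ} {ω : Z2 (G N)}
    (h : IsProjRep u ω) : u (1, 0) * u (0, 1) =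
      (ZMod.toCircle (phaseLabel N (H2.mk ω)).toAdd : ℂ) • (u (0, 1) * u (1, 0)) := by
  rw [h, h, ← commutator_eq_toCircle, smul_smul, ← Circle.coe_mul, div_mul_cancel, add_comm]

end ProjRep

theorem IsInjectiveMPS.exists_ne_zero (hA : IsInjectiveMPS A) : ∃ s, A s ≠ 0 := by
  by_contra! h
  have h1 := hA.left_canonical
  simp only [h, mul_zero, Finset.sum_const_zero] at h1
  exact hA.one_ne_zero h1.symm

namespace IsBondUnitaries

variable {v : ℕ → G N → Matrix (Fin D) (Fin D) ℂ}

/-- The projective class on neighbouring bonds is the same. -/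
theorem mk_succ_eq [NeZero N] (hU : U ^ N = 1) (hA : IsInjectiveMPS A)
    (hv : IsBondUnitaries N b U A v) (j : ℕ) {ω ω' : Z2 (G N)} (h : IsProjRep (v j) ω)
    (h' : IsProjRep (v (j + 1)) ω') : H2.mk ω = H2.mk ω' := by
  have hp := fun g => (isBondUnitaries_iff.1 hv g).push j
  choose θ hθ using hp
  obtain ⟨s, hs⟩ := hA.exists_ne_zero
  refine (H2.mk_eq_mk_iff ω ω').2 ⟨fun g => (θ g)⁻¹, fun g k => ?_⟩
  have hX : (v j (g + k))ᴴ * A s * v (j + 1) (g + k) ≠ 0 := by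
    intro h0
    have e : v j (g + k) * ((v j (g + k))ᴴ * A s * v (j + 1) (g + k)) * (v (j + 1) (g + k))ᴴ =
        v j (g + k) * (v j (g + k))ᴴ * A s * (v (j + 1) (g + k) * (v (j + 1) (g + k))ᴴ) := by
      simp only [Matrix.mul_assoc]
    rw [h0, mul_conjTranspose_self_of_mem (hv.unitary _ _),
      mul_conjTranspose_self_of_mem (hv.unitary _ _), mul_zero, zero_mul, one_mul, mul_one] at e
    exact hs e.symm
  -- Pushing `g + k` at once or `g` and `k` in succession must agree; `ω` enters conjugated through
  -- the left bond and `ω'` directly through the right one. The cocycles thus differ by the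
  -- coboundary of `θ⁻¹`.
  have key : θ (g + k) = θ k * θ g * ((ω.1 g k)⁻¹ * ω'.1 g k) := by
    refine circle_smul_cancel hX ?_
    have e := congrFun (hθ (g + k)) s
    simp only [onSite_add hU, act_mul, hθ k, act_smul_mul_mul, hθ g] at e
    rw [← e]
    calc ((θ k : ℂ)) • ((v j k)ᴴ * ((θ g : ℂ) • ((v j g)ᴴ * A s * v (j + 1) g)) * v (j + 1) k)
        = ((θ k : ℂ) * θ g) • ((v j g * v j k)ᴴ * A s * (v (j + 1) g * v (j + 1) k)) := by
          rw [Matrix.mul_smul, Matrix.smul_mul, smul_smul, Matrix.conjTranspose_mul]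
          simp only [Matrix.mul_assoc]
      _ = _ := by
          have hstar : star (ω.1 g k : ℂ) = ((ω.1 g k)⁻¹ : Circle) := by
            rw [Circle.coe_inv_eq_conj]; rfl
          rw [h, h', Matrix.conjTranspose_smul, Matrix.smul_mul, Matrix.smul_mul, Matrix.mul_smul,
            smul_smul, smul_smul, hstar]
          simp only [← Circle.coe_mul, mul_assoc]
  simp only [key, inv_inv]
  calc ω'.1 g k = ω.1 g k * ((θ g)⁻¹ * θ g * ((θ k)⁻¹ * θ k) * ((ω.1 g k)⁻¹ * ω'.1 g k)) := by
        simp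
    _ = _ := by ac_rfl

theorem exists_isProjRep [NeZero N] (hU : U ^ N = 1) (hA : IsInjectiveMPS A)
    (hv : IsBondUnitaries N b U A v) (j : ℕ) : ∃ ω, IsProjRep (v j) ω :=
  TiltedExp.exists_isProjRep hA.bond_pos (hv.unitary j) (hv.phaseEq_mul hU hA j)

end IsBondUnitaries

theorem IsSymmetricMPS.pow_eq_one (h : IsSymmetricMPS N b L U A) : U ^ N = 1 := by
  rw [← h.order, pow_orderOf_eq_one]

theorem IsSymmetricMPS.exists_hasSPTClass [NeZero N] (h : IsSymmetricMPS N b L U A) (hL : 1 ≤ L) :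
    ∃ c, HasSPTClass N b U A c := by
  have hU := h.pow_eq_one
  have hA := h.injective
  obtain ⟨v₀, hv₀⟩ := h.exists_bondUnitaries hL
  obtain ⟨ω₀, hω₀⟩ := hv₀.exists_isProjRep hU hA 0
  refine ⟨H2.mk ω₀, ⟨v₀, hv₀⟩, fun v hv j => ?_⟩
  obtain ⟨ω, hω⟩ := hv.exists_isProjRep hU hA j
  refine ⟨ω, hω, ?_⟩
  induction j generalizing ω with
  | zero =>
    exact (IsProjRep.mk_eq_of_phaseEq hA.bond_pos (hv₀.unitary 0) hω₀ hω fun g =>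
      (isBondUnitaries_iff.1 hv₀ g).phaseEq hA (isBondUnitaries_iff.1 hv g) 0).symm
  | succ j ih =>
    obtain ⟨ω', hω'⟩ := hv.exists_isProjRep hU hA j
    rw [← hv.mk_succ_eq hU hA j hω' hω, ih ω' hω']

theorem HasSPTClass.unique {c c' : H2 (G N)} (h : HasSPTClass N b U A c)
    (h' : HasSPTClass N b U A c') (hA : IsInjectiveMPS A) : c' = c := by
  obtain ⟨v, hv⟩ := h.1
  obtain ⟨ω, hω, rfl⟩ := h.2 v hv 0
  obtain ⟨ω', hω', rfl⟩ := h'.2 v hv 0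
  exact IsProjRep.mk_eq_of_phaseEq hA.bond_pos (hv.unitary 0) hω' hω fun g => PhaseEq.refl _

theorem HasSPTClass.vE_mul_vDE [NeZero N] {c : H2 (G N)} (h : HasSPTClass N b U A c)
    {v : ℕ → G N → Matrix (Fin D) (Fin D) ℂ} (hv : IsBondUnitaries N b U A v) (j : ℕ) :
    vE v j 1 * vDE v j 1 =
      (ZMod.toCircle (phaseLabel N c).toAdd : ℂ) • (vDE v j 1 * vE v j 1) := by
  obtain ⟨ω, hω, rfl⟩ := h.2 v hv j
  exact IsProjRep.mul_eq_smul hω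

theorem HasSPTClass.commutator [NeZero N] {c : H2 (G N)} (h : HasSPTClass N b U A c)
    {v : ℕ → G N → Matrix (Fin D) (Fin D) ℂ} (hv : IsBondUnitaries N b U A v) (j : ℕ) :
    vE v j 1 * vDE v j 1 * (vE v j 1)ᴴ * (vDE v j 1)ᴴ = phase N (phaseLabel N c).toAdd • 1 := by
  rw [phase_eq_toCircle]
  exact commutator_eq_smul_one (hv.unitary _ _) (hv.unitary _ _) (h.vE_mul_vDE hv j)

/-- The commutator phase `q` is the same on bonds 0 and 1, but expressing bond 1 through the
recursions yields `q ^ (b * b)`. -/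
theorem HasSPTClass.label_mul_eq_zero [NeZero N] (hA : IsInjectiveMPS A) {c : H2 (G N)}
    (h : HasSPTClass N b U A c) :
    (phaseLabel N c).toAdd * ((b : ZMod N) ^ 2 - 1) = 0 := by
  obtain ⟨v, hv⟩ := h.1
  set k := (phaseLabel N c).toAdd
  have h₀ := pow_mul_pow_of_mul_eq_smul (h.vE_mul_vDE hv 0) b b
  have h₁ := h.vE_mul_vDE hv (0 + 1)
  obtain ⟨α, hα⟩ := hv.vE_succ hA 0 1
  obtain ⟨β, hβ⟩ := hv.vDE_succ' hA 0 1
  rw [hα, hβ] at h₁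
  have hmem : vDE v 0 1 ^ b * vE v 0 1 ^ b * vE v 0 1 ^ b ∈ Matrix.unitaryGroup (Fin D) ℂ :=
    mul_mem (mul_mem (pow_mem (hv.unitary _ _) _) (pow_mem (hv.unitary _ _) _))
      (pow_mem (hv.unitary _ _) _)
  have e : ZMod.toCircle k ^ (b * b) * (α * β) = ZMod.toCircle k * (α * β) := by
    refine circle_smul_cancel (ne_zero_of_mem hA.bond_pos hmem) ?_
    simp only [Matrix.smul_mul, Matrix.mul_smul, smul_smul, ← Matrix.mul_assoc, h₀] at h₁
    simp only [Circle.coe_mul, Circle.coe_pow]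
    convert h₁ using 2
    ring
  have e' := mul_right_cancel e
  rw [← AddChar.map_nsmul_eq_pow] at e'
  have hk := ZMod.injective_toCircle e'
  rw [nsmul_eq_mul, Nat.cast_mul] at hk
  rw [mul_sub, mul_one, sub_eq_zero, mul_comm, pow_two, hk]

end Bond

/-! ### From site-wise pushing to a symmetric MPS -/

section Construct

variable {d D N b L : ℕ} {U : Matrix (Fin d) (Fin d) ℂ} {A : Fin d → Matrix (Fin D) (Fin D) ℂ}

/-- A tensor with bond unitaries for a well-defined symmetry generates symmetric states. -/
theorem IsBondUnitaries.isSymmetricMPS {v : ℕ → G N → Matrix (Fin D) (Fin D) ℂ}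
    (hv : IsBondUnitaries N b U A v) (hU : U ∈ Matrix.unitaryGroup (Fin d) ℂ)
    (ho : orderOf U = N) (hL₁ : L ≡ 0 [MOD N]) (hL₂ : b ^ L ≡ 1 [MOD N])
    (hA : IsInjectiveMPS A) : IsSymmetricMPS N b L U A := by
  obtain ⟨h₁, h₂⟩ := (wellDefinedOnRing_iff hU ho).2 ⟨hL₁, hL₂⟩
  refine ⟨hU, ho, h₁, h₂, hA, fun g k _ => ?_⟩
  have hg := isBondUnitaries_iff.1 hv g
  -- The site operators are `L`-periodic, hence by uniqueness so are the bond unitaries up to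
  -- phases; cyclicity of the trace then cancels the two end unitaries.
  have hper : ∀ j, PhaseEq (v (j + L) g) (v j g) := by
    intro j
    have hs := hg.shift L
    simp only [onSite_periodic h₁ h₂] at hs
    exact hg.phaseEq hA hs j
  have hk : PhaseEq (v (k * L) g) (v 0 g) := by
    clear * - hper
    induction k with
    | zero => rw [zero_mul]; exact PhaseEq.refl _
    | succ k ih => rw [Nat.succ_mul]; exact (hper (k * L)).trans ih
  obtain ⟨c, hc⟩ := hg.prod_act (k * L)
  obtain ⟨c', hc'⟩ := hk
  refine ⟨c * c', funext fun σ => ?_⟩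
  rw [symOp, chainOp_mulVec_mpsState]
  simp only [onSite_mod h₁ h₂]
  rw [hc, hc', Matrix.trace_smul, Matrix.mul_smul, Matrix.trace_smul, Matrix.trace_mul_comm,
    ← Matrix.mul_assoc, mul_conjTranspose_self_of_mem (hv.unitary 0 g), one_mul, smul_smul,
    ← Circle.coe_mul]
  rfl

/-- Bond unitary of the dipole-exponential generator, built recursively from those of the first
bond. -/
def dipoleBond (b : ℕ) (x y : Matrix (Fin D) (Fin D) ℂ) : ℕ → Matrix (Fin D) (Fin D) ℂ
  | 0 => y
  | j + 1 => dipoleBond b x y j ^ b * x ^ b ^ (j + 1)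

/-- Bond unitaries on the first site determine bond unitaries everywhere. -/
theorem exists_isBondUnitaries {x y : Matrix (Fin D) (Fin D) ℂ}
    (hx : x ∈ Matrix.unitaryGroup (Fin D) ℂ) (hy : y ∈ Matrix.unitaryGroup (Fin D) ℂ)
    (hUx : PushSite U A x (x ^ b)) (hUy : PushSite U A y (y ^ b * x ^ b)) :
    IsBondUnitaries N b U A fun j g => (x ^ b ^ j) ^ g.1.val * dipoleBond b x y j ^ g.2.val := by
  have hX : ∀ j, PushSite (U ^ b ^ j) A (x ^ b ^ j) (x ^ b ^ (j + 1)) := by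
    intro j
    have h := hUx.pow (b ^ j)
    rwa [← pow_mul x, ← pow_succ'] at h
  -- The exponent at site `j + 1` obeys the same recursion as `dipoleBond`.
  have hY : ∀ j, PushSite (U ^ ((j + 1) * b ^ j)) A (dipoleBond b x y j)
      (dipoleBond b x y (j + 1)) := by
    intro j
    induction j with
    | zero => simpa [dipoleBond] using hUy
    | succ j ih =>
      have h := (ih.pow b).mul (hX (j + 1))
      rw [← pow_mul, ← pow_add] at h
      have e : (j + 1) * b ^ j * b + b ^ (j + 1) = (j + 1 + 1) * b ^ (j + 1) := by ring
      rwa [e] at h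
  have hYu : ∀ j, dipoleBond b x y j ∈ Matrix.unitaryGroup (Fin D) ℂ := by
    intro j
    induction j with
    | zero => exact hy
    | succ j ih => exact mul_mem (pow_mem ih _) (pow_mem hx _)
  refine isBondUnitaries_iff.2 fun g => ⟨fun j => ?_, fun j => ?_⟩
  · exact mul_mem (pow_mem (pow_mem hx _) _) (pow_mem (hYu j) _)
  · rw [onSite_eq_pow, expMod, dipExpMod, Nat.add_sub_cancel]
    have h := ((hX j).pow g.1.val).mul ((hY j).pow g.2.val)
    rwa [← pow_mul U, ← pow_mul U, ← pow_add, mul_comm (b ^ j), mul_comm ((j + 1) * b ^ j)] at h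

end Construct

/-! ### The clock-and-shift model -/

section Labels

theorem permMatrix_pow {m : Type*} [Fintype m] [DecidableEq m] (σ : Equiv.Perm m) (k : ℕ) :
    σ.permMatrix ℂ ^ k = (σ ^ k).permMatrix ℂ := by
  induction k with
  | zero => simp
  | succ k ih => rw [pow_succ, ih, pow_succ', Matrix.permMatrix_mul]

/-- Labels of the basis states. -/
abbrev lbl (n : ℕ) [NeZero n] : Fin n ≃ ZMod n := (ZMod.finEquiv n).toEquiv

variable {N : ℕ} [NeZero N]

/-- Reduction of a physical label to a bond label. -/
def red {n : ℕ} (hnN : n ∣ N) (s : Fin N) : ZMod n := ZMod.castHom hnN (ZMod n) (lbl N s)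

/-- The next physical label. -/
def succLbl (N : ℕ) [NeZero N] : Equiv.Perm (Fin N) :=
  (lbl N).trans ((Equiv.addRight 1).trans (lbl N).symm)

theorem lbl_succLbl_pow (m : ℕ) (s : Fin N) : lbl N ((succLbl N ^ m) s) = lbl N s + m := by
  induction m with
  | zero => simp
  | succ m ih =>
    rw [pow_succ', Equiv.Perm.mul_apply]
    simp only [succLbl, Equiv.trans_apply, Equiv.apply_symm_apply, Equiv.coe_addRight] at ih ⊢
    rw [ih, Nat.cast_succ, add_assoc]

theorem red_succLbl {n : ℕ} (hnN : n ∣ N) (s : Fin N) : red hnN (succLbl N s) = red hnN s + 1 := by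
  simp only [red, succLbl, Equiv.trans_apply, Equiv.apply_symm_apply, Equiv.coe_addRight, map_add,
    map_one]

/-- The cyclic shift on the physical basis. -/
def shiftU (N : ℕ) [NeZero N] : Matrix (Fin N) (Fin N) ℂ := (succLbl N).permMatrix ℂ

theorem shiftU_mem : shiftU N ∈ Matrix.unitaryGroup (Fin N) ℂ := by
  rw [Matrix.mem_unitaryGroup_iff, Matrix.star_eq_conjTranspose, shiftU,
    Matrix.conjTranspose_permMatrix, ← Matrix.permMatrix_mul, inv_mul_cancel,
    Matrix.permMatrix_one]

theorem orderOf_shiftU : orderOf (shiftU N) = N := by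
  have key : ∀ m : ℕ, shiftU N ^ m = 1 ↔ N ∣ m := by
    intro m
    rw [shiftU, permMatrix_pow, ← ZMod.natCast_eq_zero_iff]
    constructor
    · intro h
      by_contra h0
      obtain ⟨x, hx⟩ := (lbl N).surjective 0
      have e := congrFun (congrFun h x) x
      have hne : (succLbl N ^ m) x ≠ x := by
        intro h1
        have h2 := lbl_succLbl_pow m x
        rw [h1, hx, zero_add] at h2
        exact h0 h2.symm
      simp [Equiv.Perm.permMatrix, PEquiv.toMatrix_apply, hne] at e
    · intro h
      have h1 : succLbl N ^ m = 1 := by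
        ext1 s
        apply (lbl N).injective
        rw [lbl_succLbl_pow, h, add_zero, Equiv.Perm.one_apply]
      rw [h1, Matrix.permMatrix_one]
  refine Nat.dvd_antisymm (orderOf_dvd_of_pow_eq_one ((key N).2 dvd_rfl))
    ((key _).1 (pow_orderOf_eq_one _))

theorem act_shiftU {D : ℕ} (A : Fin N → Matrix (Fin D) (Fin D) ℂ) (s : Fin N) :
    act (shiftU N) A s = A (succLbl N s) := by
  simp [act, shiftU, Equiv.Perm.permMatrix, PEquiv.toMatrix_apply, eq_comm]

end Labels

/-! ### Generalised Pauli matrices and the cluster-like tensor -/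

section Clock

variable {n : ℕ} [NeZero n] (χ : AddChar (ZMod n) Circle)

/-- The generalised Pauli matrix `Z^p X^q`. -/
def pauli (p q : ZMod n) : Matrix (Fin n) (Fin n) ℂ :=
  fun a c => if c = (lbl n).symm (lbl n a + q) then (χ (p * lbl n a) : ℂ) else 0

theorem pauli_mul_apply (p q : ZMod n) (M : Matrix (Fin n) (Fin n) ℂ) (a c : Fin n) :
    (pauli χ p q * M) a c = χ (p * lbl n a) * M ((lbl n).symm (lbl n a + q)) c := by
  simp only [Matrix.mul_apply, pauli, ite_mul, zero_mul, Finset.sum_ite_eq',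
    Finset.mem_univ, if_true]

theorem pauli_mul (p q p' q' : ZMod n) :
    pauli χ p q * pauli χ p' q' = (χ (p' * q) : ℂ) • pauli χ (p + p') (q + q') := by
  ext a c
  rw [pauli_mul_apply, Matrix.smul_apply, smul_eq_mul]
  simp only [pauli, Equiv.apply_symm_apply, mul_ite, mul_zero, add_assoc]
  congr 1
  rw [← Circle.coe_mul, ← Circle.coe_mul, ← AddChar.map_add_eq_mul, ← AddChar.map_add_eq_mul]
  congr 2
  ring

theorem pauli_zero : pauli χ 0 0 = 1 := by
  ext a c
  simp [pauli, Matrix.one_apply, eq_comm]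

theorem phaseEq_pauli_pow (p q : ZMod n) (m : ℕ) :
    PhaseEq (pauli χ p q ^ m) (pauli χ (m * p) (m * q)) := by
  induction m with
  | zero => rw [pow_zero, Nat.cast_zero, zero_mul, zero_mul, pauli_zero]; exact PhaseEq.refl _
  | succ m ih =>
    rw [pow_succ]
    refine (ih.mul (PhaseEq.refl _)).trans ⟨χ (p * (m * q)), ?_⟩
    rw [pauli_mul, Nat.cast_succ, add_mul, one_mul, add_mul, one_mul]

theorem pauli_mem (p q : ZMod n) : pauli χ p q ∈ Matrix.unitaryGroup (Fin n) ℂ := by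
  rw [Matrix.mem_unitaryGroup_iff]
  ext a c
  simp only [Matrix.star_eq_conjTranspose, Matrix.mul_apply, Matrix.conjTranspose_apply, pauli,
    ite_mul, zero_mul, Finset.sum_ite_eq', Finset.mem_univ, if_true, Matrix.one_apply]
  by_cases h : a = c
  · subst h
    simp [← Circle.coe_inv_eq_conj]
  · rw [if_neg h, if_neg (by simpa using h), star_zero, mul_zero]

variable {N : ℕ} [NeZero N] (hnN : n ∣ N) (b : ℕ)

/-- The cluster-like tensor `A^s = N^{-1/2} χ(as - bs²) |a⟩⟨s|`. -/
def clusterTensor (s : Fin N) : Matrix (Fin n) (Fin n) ℂ :=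
  fun a c => if c = (lbl n).symm (red hnN s) then
    ((√(N : ℝ) : ℝ) : ℂ)⁻¹ * χ (lbl n a * red hnN s - b * red hnN s ^ 2) else 0

theorem clusterTensor_mul_apply (s : Fin N) (M : Matrix (Fin n) (Fin n) ℂ) (a c : Fin n) :
    (clusterTensor χ hnN b s * M) a c =
      ((√(N : ℝ) : ℝ) : ℂ)⁻¹ * χ (lbl n a * red hnN s - b * red hnN s ^ 2) *
        M ((lbl n).symm (red hnN s)) c := by
  simp only [Matrix.mul_apply, clusterTensor, ite_mul, zero_mul, Finset.sum_ite_eq',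
    Finset.mem_univ, if_true]

/-- Replacing `s` by `s + 1` and `a` by `a + b` changes the exponent `as - bs²` by `a - bs`: a clock
factor on each bond. The quadratic term is tuned for this, and `b² = 1` identifies the right factor
`Z^(-b) X` with the `b`-th power of the left one. -/
theorem pushSite_shiftU_x (hb : (b : ZMod n) ^ 2 = 1) :
    PushSite (shiftU N) (clusterTensor χ hnN b) (pauli χ (-1) b) (pauli χ (-1) b ^ b) := by
  refine PushSite.congr_right (q := pauli χ (-b) 1) ?_ ?_
  · refine PushSite.of_mul_eq (pauli_mem χ _ _) 1 fun s => ?_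
    rw [act_shiftU]
    ext a c
    rw [Circle.coe_one, one_smul, pauli_mul_apply, clusterTensor_mul_apply]
    simp only [pauli, clusterTensor, Equiv.apply_symm_apply, red_succLbl, mul_ite, mul_zero]
    congr 1
    rw [mul_left_comm, mul_assoc, ← Circle.coe_mul, ← Circle.coe_mul, ← AddChar.map_add_eq_mul,
      ← AddChar.map_add_eq_mul]
    congr 3
    ring
  · have h := phaseEq_pauli_pow χ (-1) (b : ZMod n) b
    rw [← pow_two, hb, mul_neg_one] at h
    exact h.symm

/-- With `a` unshifted the exponent changes by `a - 2bs - b`; the constant `-b` is the phase and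
`Z^(-2b) X` the right bond unitary. -/
theorem pushSite_shiftU_y (hb : (b : ZMod n) ^ 2 = 1) :
    PushSite (shiftU N) (clusterTensor χ hnN b) (pauli χ (-1) 0)
      (pauli χ (-1) 0 ^ b * pauli χ (-1) b ^ b) := by
  refine PushSite.congr_right (q := pauli χ (-(2 * b)) 1) ?_ ?_
  · refine PushSite.of_mul_eq (pauli_mem χ _ _) (χ (-b)) fun s => ?_
    rw [act_shiftU]
    ext a c
    rw [Matrix.smul_apply, smul_eq_mul, pauli_mul_apply, clusterTensor_mul_apply]
    simp only [pauli, clusterTensor, Equiv.apply_symm_apply, red_succLbl, mul_ite, mul_zero,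
      add_zero]
    congr 1
    rw [mul_left_comm, mul_assoc, mul_left_comm (χ (-b) : ℂ), ← Circle.coe_mul, ← Circle.coe_mul,
      ← Circle.coe_mul, ← AddChar.map_add_eq_mul, ← AddChar.map_add_eq_mul,
      ← AddChar.map_add_eq_mul]
    congr 3
    ring
  · have h₁ := phaseEq_pauli_pow χ (-1) (b : ZMod n) b
    have h₂ := phaseEq_pauli_pow χ (-1) (0 : ZMod n) b
    rw [← pow_two, hb, mul_neg_one] at h₁
    rw [mul_zero, mul_neg_one] at h₂
    refine ((h₂.mul h₁).trans ⟨χ (-b * 0), ?_⟩).symm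
    rw [pauli_mul, zero_add]
    congr 2
    ring

theorem pauli_commutator : pauli χ (-1) b * pauli χ (-1) 0 =
    (χ (-b) : ℂ) • (pauli χ (-1) 0 * pauli χ (-1) b) := by
  rw [pauli_mul, pauli_mul, smul_smul, mul_zero, AddChar.map_zero_eq_one, Circle.coe_one, mul_one,
    neg_one_mul, add_zero, zero_add]

/-- All fibres of the reduction have the same size; averaging over translates avoids counting them.
-/
theorem sum_red (f : ZMod n → ℂ) :
    (N : ℂ)⁻¹ * ∑ s : Fin N, f (red hnN s) = (n : ℂ)⁻¹ * ∑ t, f t := by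
  have hsurj : Function.Surjective (ZMod.castHom hnN (ZMod n)) := ZMod.castHom_surjective hnN
  have e₁ : ∑ s : Fin N, f (red hnN s) = ∑ z : ZMod N, f (ZMod.castHom hnN (ZMod n) z) :=
    (lbl N).sum_comp fun z => f (ZMod.castHom hnN (ZMod n) z)
  have e₂ : ∀ t, ∑ z : ZMod N, f (ZMod.castHom hnN (ZMod n) z + t) =
      ∑ z : ZMod N, f (ZMod.castHom hnN (ZMod n) z) := by
    intro t
    obtain ⟨w, rfl⟩ := hsurj t
    simp only [← map_add]
    exact Equiv.sum_comp (Equiv.addRight w) fun z => f (ZMod.castHom hnN (ZMod n) z)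
  have e₃ : (n : ℂ) * ∑ s : Fin N, f (red hnN s) = N * ∑ t, f t := by
    calc _ = ∑ t : ZMod n, ∑ z : ZMod N, f (ZMod.castHom hnN (ZMod n) z + t) := by
          simp only [e₁, e₂, Finset.sum_const, Finset.card_univ, ZMod.card, nsmul_eq_mul]
      _ = ∑ z : ZMod N, ∑ t : ZMod n, f (ZMod.castHom hnN (ZMod n) z + t) := Finset.sum_comm
      _ = ∑ z : ZMod N, ∑ t : ZMod n, f t :=
          Finset.sum_congr rfl fun z _ => Equiv.sum_comp (Equiv.addLeft _) f
      _ = _ := by simp [ZMod.card]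
  have hn : (n : ℂ) ≠ 0 := NeZero.ne _
  have hN : (N : ℂ) ≠ 0 := NeZero.ne _
  rw [inv_mul_eq_iff_eq_mul₀ hN, mul_left_comm, ← e₃, inv_mul_cancel_left₀ hn]

theorem sum_char (hχ : ∀ t, χ t = 1 → t = 0) (z : ZMod n) :
    ∑ t, (χ (t * z) : ℂ) = if z = 0 then (n : ℂ) else 0 := by
  have hp : (Circle.coeHom.compAddChar χ).IsPrimitive := by
    intro a ha h
    have h1 := congrArg (fun ψ : AddChar (ZMod n) ℂ => ψ 1) h
    simp only [AddChar.mulShift_apply, mul_one, AddChar.one_apply] at h1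
    exact ha (hχ a (Circle.ext h1))
  have h := AddChar.sum_mulShift z hp
  rw [ZMod.card] at h
  refine Eq.trans (Finset.sum_congr rfl fun t _ => rfl) (h.trans ?_)
  split_ifs <;> simp

theorem clusterTensor_star_mul (s : Fin N) (a a' c c' : Fin n) :
    star (clusterTensor χ hnN b s a c) * clusterTensor χ hnN b s a' c' =
      if c = (lbl n).symm (red hnN s) then if c' = (lbl n).symm (red hnN s) then
        (N : ℂ)⁻¹ * χ (red hnN s * (lbl n a' - lbl n a)) else 0 else 0 := by
  have hN : star ((√(N : ℝ) : ℝ) : ℂ)⁻¹ * ((√(N : ℝ) : ℝ) : ℂ)⁻¹ = (N : ℂ)⁻¹ := by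
    have : star ((√(N : ℝ) : ℝ) : ℂ)⁻¹ = ((√(N : ℝ) : ℝ) : ℂ)⁻¹ := by simp
    rw [this, ← mul_inv, ← Complex.ofReal_mul, Real.mul_self_sqrt (Nat.cast_nonneg N),
      Complex.ofReal_natCast]
  have hc : ∀ t : ZMod n, star (χ t : ℂ) = χ (-t) := by
    intro t
    rw [AddChar.map_neg_eq_inv, Circle.coe_inv_eq_conj]
    rfl
  unfold clusterTensor
  split_ifs
  · rw [star_mul', mul_mul_mul_comm, hN, hc, ← Circle.coe_mul, ← AddChar.map_add_eq_mul]
    congr 3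
    ring
  all_goals simp

/-- The right index equals the reduced physical label, so the output is diagonal, and the quadratic
phases cancel against their conjugates. Diagonal inputs go to multiples of `1`. -/
theorem transfer_clusterTensor (X : Matrix (Fin n) (Fin n) ℂ) :
    transfer (clusterTensor χ hnN b) X = Matrix.diagonal fun c =>
      (n : ℂ)⁻¹ * ∑ a, ∑ a', X a a' * χ (lbl n c * (lbl n a' - lbl n a)) := by
  ext c c'
  have h : ∀ s, ((clusterTensor χ hnN b s)ᴴ * X * clusterTensor χ hnN b s) c c' =
      (N : ℂ)⁻¹ * (if c = (lbl n).symm (red hnN s) then if c' = (lbl n).symm (red hnN s) then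
        ∑ a, ∑ a', X a a' * χ (red hnN s * (lbl n a' - lbl n a)) else 0 else 0) := by
    intro s
    simp only [Matrix.mul_apply, Matrix.conjTranspose_apply, Finset.sum_mul]
    rw [Finset.sum_comm]
    have e : ∀ a a', star (clusterTensor χ hnN b s a c) * X a a' * clusterTensor χ hnN b s a' c' =
        X a a' * (star (clusterTensor χ hnN b s a c) * clusterTensor χ hnN b s a' c') := by
      intro a a'; ring
    simp only [e, clusterTensor_star_mul]
    split_ifs
    · simp only [Finset.mul_sum]
      exact Finset.sum_congr rfl fun a _ => Finset.sum_congr rfl fun a' _ => mul_left_comm _ _ _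
    all_goals simp
  rw [transfer, Matrix.sum_apply, Finset.sum_congr rfl fun s _ => h s, ← Finset.mul_sum,
    sum_red hnN fun t => if c = (lbl n).symm t then if c' = (lbl n).symm t then
        ∑ a, ∑ a', X a a' * (χ (t * (lbl n a' - lbl n a)) : ℂ) else 0 else 0]
  simp only [Equiv.eq_symm_apply, Finset.sum_ite_eq, Finset.mem_univ, if_true,
    Matrix.diagonal_apply, mul_ite, mul_zero, EmbeddingLike.apply_eq_iff_eq]
  simp only [eq_comm]

/-- Faithfulness of `χ` serves the right fixed point `ρ = 1`, through orthogonality of characters.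
For the gap, an eigenvector with `μ ≠ 0` is diagonal, hence mapped to a multiple of `1`, hence
itself such a multiple. -/
theorem isInjectiveMPS_clusterTensor (hχ : ∀ t, χ t = 1 → t = 0) :
    IsInjectiveMPS (clusterTensor χ hnN b) where
  bond_pos := NeZero.pos n
  left_canonical := by
    have h := transfer_clusterTensor χ hnN b 1
    have hn : (n : ℂ) ≠ 0 := NeZero.ne _
    simp only [transfer, mul_one] at h
    rw [h]
    ext c c'
    simp [Matrix.diagonal_apply, Matrix.one_apply, hn]
  right_canonical := by
    refine ⟨1, Matrix.PosDef.one, ?_⟩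
    ext a a'
    have hn : (n : ℂ) ≠ 0 := NeZero.ne _
    have h : ∀ s : Fin N, (clusterTensor χ hnN b s * (1 : Matrix (Fin n) (Fin n) ℂ) *
        (clusterTensor χ hnN b s)ᴴ) a a' =
        (N : ℂ)⁻¹ * χ (red hnN s * (lbl n a - lbl n a')) := by
      intro s
      simp only [mul_one, Matrix.mul_apply, Matrix.conjTranspose_apply]
      simp only [mul_comm (clusterTensor χ hnN b s a _), clusterTensor_star_mul]
      simp only [Finset.sum_ite_eq', Finset.mem_univ, if_true]
    rw [Matrix.sum_apply, Finset.sum_congr rfl fun s _ => h s, ← Finset.mul_sum,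
      sum_red hnN fun t => (χ (t * (lbl n a - lbl n a')) : ℂ), sum_char χ hχ, Matrix.one_apply]
    by_cases haa : a = a'
    · simp [haa, hn]
    · rw [if_neg haa, if_neg (sub_ne_zero.2 fun h => haa ((lbl n).injective h)), mul_zero]
  gap μ X hX h := by
    by_cases hμ : μ = 0
    · left
      simp [hμ]
    right
    have hn : (n : ℂ) ≠ 0 := NeZero.ne _
    have hdiag : ∀ a a', a ≠ a' → X a a' = 0 := by
      intro a a' ha
      have e := congrFun (congrFun h a) a'
      rw [transfer_clusterTensor, Matrix.diagonal_apply_ne _ ha, Matrix.smul_apply,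
        smul_eq_mul] at e
      exact (mul_eq_zero.1 e.symm).resolve_left hμ
    have htr : transfer (clusterTensor χ hnN b) X = ((n : ℂ)⁻¹ * X.trace) • 1 := by
      rw [transfer_clusterTensor, Matrix.smul_one_eq_diagonal]
      congr 1
      funext c
      congr 1
      refine Finset.sum_congr rfl fun a _ => ?_
      rw [Finset.sum_eq_single a (fun a' _ ha => by rw [hdiag a a' ha.symm, zero_mul]) (by simp)]
      simp
    have hXs : X = (μ⁻¹ * ((n : ℂ)⁻¹ * X.trace)) • 1 := by
      rw [mul_smul, ← htr, h, smul_smul, inv_mul_cancel₀ hμ, one_smul]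
    refine ⟨?_, _, hXs⟩
    have ht : X.trace ≠ 0 := by
      intro h0
      rw [h0, mul_zero, mul_zero, zero_smul] at hXs
      exact hX hXs
    have e := congrArg Matrix.trace hXs
    rw [Matrix.trace_smul, Matrix.trace_one, Fintype.card_fin, smul_eq_mul] at e
    have e' : μ⁻¹ * X.trace = 1 * X.trace := by
      rw [one_mul]
      conv_rhs => rw [e]
      field_simp
    exact inv_eq_one.1 (mul_right_cancel₀ ht e')

end Clock

/-- Every class allowed by `k (b² - 1) = 0` is realised. -/
theorem isSPTClass_of_label_mul_eq_zero {N b L : ℕ} [NeZero N] (hL : 1 ≤ L)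
    (hL₁ : L ≡ 0 [MOD N]) (hL₂ : b ^ L ≡ 1 [MOD N]) {c : H2 (G N)}
    (hc : (phaseLabel N c).toAdd * ((b : ZMod N) ^ 2 - 1) = 0) : IsSPTClass N b L c := by
  set k := (phaseLabel N c).toAdd with hk
  have hkb : k * (b : ZMod N) ^ 2 = k := by rwa [mul_sub, mul_one, sub_eq_zero] at hc
  -- This makes the commutator phase `χ(-b)` of the Pauli bonds equal to `exp(2πi b²k/N) = exp(2πi
  -- k/N)`.
  set ζ : Circle := ZMod.toCircle (-((b : ZMod N) * k)) with hζ
  have hζm : ∀ m : ℕ, ζ ^ m = ZMod.toCircle ((m : ZMod N) * -((b : ZMod N) * k)) := by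
    intro m
    rw [hζ, ← AddChar.map_nsmul_eq_pow, nsmul_eq_mul]
  have hζN : ζ ^ N = 1 := by
    rw [hζm, CharP.cast_eq_zero, zero_mul, AddChar.map_zero_eq_one]
  have hnN : orderOf ζ ∣ N := orderOf_dvd_of_pow_eq_one hζN
  have : NeZero (orderOf ζ) := ⟨fun h => NeZero.ne N (Nat.eq_zero_of_zero_dvd (h ▸ hnN))⟩
  set n := orderOf ζ with hn
  have hζn : ζ ^ n = 1 := pow_orderOf_eq_one ζ
  -- Although `b²` need not be 1 modulo `N`, it is modulo the order of `ζ`, because `k b² = k`.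
  have hb : (b : ZMod n) ^ 2 = 1 := by
    have h : ζ ^ (b ^ 2) = ζ ^ 1 := by
      rw [hζm, hζm, Nat.cast_pow, Nat.cast_one, one_mul, mul_neg, mul_left_comm, mul_comm _ k, hkb]
    have h2 := (ZMod.natCast_eq_natCast_iff _ _ _).2 (pow_eq_pow_iff_modEq.1 h)
    rwa [Nat.cast_pow, Nat.cast_one] at h2
  set χ : AddChar (ZMod n) Circle := AddChar.zmodChar n hζn with hχd
  have hχ : ∀ t, χ t = 1 → t = 0 := by
    intro t ht
    rw [hχd, AddChar.zmodChar_apply] at ht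
    exact (ZMod.val_eq_zero t).1
      (Nat.eq_zero_of_dvd_of_lt (orderOf_dvd_of_pow_eq_one ht) (ZMod.val_lt t))
  have hχb : χ (-b) = ZMod.toCircle k := by
    rw [AddChar.map_neg_eq_inv, hχd, AddChar.zmodChar_apply', hζm, ← AddChar.map_neg_eq_inv,
      mul_neg, neg_neg, ← mul_assoc, ← pow_two, mul_comm, hkb]
  have hA := isInjectiveMPS_clusterTensor χ hnN b hχ
  have hv := exists_isBondUnitaries (N := N) (pauli_mem χ (-1) (b : ZMod n))
    (pauli_mem χ (-1) 0) (pushSite_shiftU_x χ hnN b hb) (pushSite_shiftU_y χ hnN b hb)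
  have hsym := hv.isSymmetricMPS shiftU_mem orderOf_shiftU hL₁ hL₂ hA
  obtain ⟨c', hc'⟩ := hsym.exists_hasSPTClass hL
  refine ⟨N, n, shiftU N, clusterTensor χ hnN b, hsym, ?_⟩
  suffices h : c' = c by rwa [← h]
  apply (phaseLabel N).injective
  change (phaseLabel N c').toAdd = (phaseLabel N c).toAdd
  -- For `N = 1` the representative of `1` is 0, so the generators would not give the Pauli
  -- matrices.
  by_cases hN1 : N = 1
  · subst hN1
    exact Subsingleton.elim _ _
  have h1 : (1 : ZMod N).val = 1 := by
    have : Fact (1 < N) := ⟨by have := NeZero.pos N; omega⟩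
    exact ZMod.val_one N
  have h := hc'.vE_mul_vDE hv 0
  simp only [vE, vDE, h1, ZMod.val_zero, pow_zero, pow_one, mul_one, one_mul, dipoleBond,
    pauli_commutator, hχb] at h
  have h2 := smul_right_cancel_of_mem (NeZero.pos n)
    (mul_mem (pauli_mem χ (-1) 0) (pauli_mem χ (-1) (b : ZMod n))) h
  exact (ZMod.injective_toCircle (Circle.ext h2)).symm

end TiltedExp

end

/-! ### Periodicity, bond unitaries and classification combined -/

theorem mainTheorem11 (N b L : ℕ) (hN : 1 ≤ N) (hb : 1 ≤ b) (hL : 1 ≤ L) :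
    -- periodicity
    (∀ (d : ℕ) (U : Matrix (Fin d) (Fin d) ℂ), U ∈ Matrix.unitaryGroup (Fin d) ℂ →
      orderOf U = N →
      ((TiltedExp.WellDefinedOnRing U (TiltedExp.expMod b) L ∧
          TiltedExp.WellDefinedOnRing U (TiltedExp.dipExpMod b) L) ↔
        (L ≡ 0 [MOD N] ∧ b ^ L ≡ 1 [MOD N]))) ∧
    (L ≡ 0 [MOD N] → b ^ L ≡ 1 [MOD N] → Nat.Coprime b N) ∧
    (Nat.Coprime b N → ∀ k : ℕ, k * Nat.totient N * N ≡ 0 [MOD N] ∧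
      b ^ (k * Nat.totient N * N) ≡ 1 [MOD N]) ∧
    -- the class in `H²(ℤ_N × ℤ_N, U(1)) ≅ ℤ_N` is read off from the commutator phase
    ∃ κ : TiltedExp.H2 (TiltedExp.G N) ≃* Multiplicative (ZMod N),
      (∀ ω : TiltedExp.Z2 (TiltedExp.G N),
        (ω.1 (1, 0) (0, 1) : ℂ) / (ω.1 (0, 1) (1, 0) : ℂ) =
          TiltedExp.phase N (κ (TiltedExp.H2.mk ω)).toAdd) ∧
      -- bond unitaries of a symmetric MPS
      (∀ (d D : ℕ) (U : Matrix (Fin d) (Fin d) ℂ) (A : Fin d → Matrix (Fin D) (Fin D) ℂ),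
        TiltedExp.IsSymmetricMPS N b L U A →
        (∃ v, TiltedExp.IsBondUnitaries N b U A v) ∧
        (∀ v, TiltedExp.IsBondUnitaries N b U A v → ∀ (j : ℕ) (g : ZMod N),
          TiltedExp.PhaseEq (TiltedExp.vE v (j + 1) g) (TiltedExp.vE v j g ^ b) ∧
          TiltedExp.PhaseEq (TiltedExp.vDE v (j + 1) g)
            (TiltedExp.vDE v j g ^ b * TiltedExp.vE v (j + 1) g) ∧
          TiltedExp.PhaseEq (TiltedExp.vDE v (j + 1) g)
            (TiltedExp.vDE v j g ^ b * TiltedExp.vE v j g ^ b)) ∧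
        ∃ c : TiltedExp.H2 (TiltedExp.G N), TiltedExp.HasSPTClass N b U A c ∧
          (∀ c', TiltedExp.HasSPTClass N b U A c' → c' = c) ∧
          (∀ v, TiltedExp.IsBondUnitaries N b U A v → ∀ j : ℕ,
            TiltedExp.vE v j 1 * TiltedExp.vDE v j 1 * (TiltedExp.vE v j 1)ᴴ *
                (TiltedExp.vDE v j 1)ᴴ =
              TiltedExp.phase N (κ c).toAdd • (1 : Matrix (Fin D) (Fin D) ℂ)) ∧
          (κ c).toAdd * ((b : ZMod N) ^ 2 - 1) = 0) ∧
      -- classification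
      (L ≡ 0 [MOD N] → b ^ L ≡ 1 [MOD N] →
        (∀ c : TiltedExp.H2 (TiltedExp.G N), TiltedExp.IsSPTClass N b L c ↔
          (κ c).toAdd * ((b : ZMod N) ^ 2 - 1) = 0) ∧
        ∃ P : Subgroup (TiltedExp.H2 (TiltedExp.G N)),
          (∀ c, c ∈ P ↔ TiltedExp.IsSPTClass N b L c) ∧
          Nonempty (P ≃* Multiplicative (ZMod (Nat.gcd (b ^ 2 - 1) N)))) := by
  have : NeZero N := ⟨by omega⟩
  refine ⟨fun d U hU ho => TiltedExp.wellDefinedOnRing_iff hU ho, fun _ h => ?_, fun h k => ?_,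
    TiltedExp.phaseLabel N, fun ω => ?_, fun d D U A hA => ?_, fun hL₁ hL₂ => ?_⟩
  · have hg := Nat.ModEq.gcd_eq h
    rw [Nat.gcd_one_left] at hg
    exact Nat.Coprime.coprime_dvd_left (dvd_pow_self b (by omega)) hg
  · refine ⟨(Nat.modEq_zero_iff_dvd).2 (dvd_mul_left _ _), ?_⟩
    have e := (Nat.ModEq.pow_totient h).pow (k * N)
    rwa [one_pow, ← pow_mul, show N.totient * (k * N) = k * N.totient * N by ring] at e
  · rw [TiltedExp.phase_eq_toCircle, ← TiltedExp.commutator_eq_toCircle, Circle.coe_div]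
  · obtain ⟨c, hc⟩ := hA.exists_hasSPTClass hL
    exact ⟨hc.1, fun v hv j g => ⟨hv.vE_succ hA.injective j g, hv.vDE_succ hA.injective j g,
      hv.vDE_succ' hA.injective j g⟩, c, hc, fun c' hc' => hc.unique hc' hA.injective,
      fun v hv j => hc.commutator hv j, hc.label_mul_eq_zero hA.injective⟩
  · have hiff : ∀ c, TiltedExp.IsSPTClass N b L c ↔
        (TiltedExp.phaseLabel N c).toAdd * ((b : ZMod N) ^ 2 - 1) = 0 := by
      refine fun c => ⟨?_, TiltedExp.isSPTClass_of_label_mul_eq_zero hL hL₁ hL₂⟩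
      rintro ⟨d, D, U, A, hA, hc⟩
      exact hc.label_mul_eq_zero hA.injective
    obtain ⟨P, hP, hP'⟩ := TiltedExp.exists_torsion_subgroup (TiltedExp.phaseLabel N) (b ^ 2 - 1)
    refine ⟨hiff, P, fun c => ?_, hP'⟩
    -- Since `b ≥ 1`, the truncated subtraction in `b ^ 2 - 1` is genuine and commutes with the
    -- cast.
    rw [hP, hiff, Nat.cast_sub (Nat.one_le_pow _ _ hb), Nat.cast_pow, Nat.cast_one]
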